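/- Let $H$ be an infinite-dimensional separable complex Hilbert space. A linear operator $A$ in $H$ is accretive if $\operatorname{Re}(Au,u)\ge 0$ for $u\in\operatorname{dom}A$, and $m$-accretive if in addition it is densely defined and $\operatorname{ran}(A-\lambda I)=H$ for some $\lambda$ with $\operatorname{Re}\lambda<0$. It is $m$-$\alpha$-sectorial, $\alpha\in[0,\pi/2)$, if it is $m$-accretive and $|\arg (Au,u)|\le\alpha$ for all unit vectors $u\in\operatorname{dom}A$. For $m$-accretive $A$ and $\gamma\in(0,1)$, $A^\gamma$ is the closure of the operator $u\mapsto \frac{\sin \gamma\pi}{\pi}\int_0^\infty t^{\gamma-1}A(A+tI)^{-1}u\,dt$, $u\in\operatorname{dom}A$; and $A^{*1/2}:=(A^*)^{1/2}$. Set $\operatorname{Re}A=\frac12(A+A^*)$ and $\operatorname{Im}A=\frac1{2i}(A-A^*)$ on $\operatorname{dom}A\cap\operatorname{dom}A^*$. For $\alpha\in(0,\pi/2)$, $C_H(\alpha)$ is the class of everywhere defined bounded operators $Z$ with $\|Z\sin\alpha\pm i\cos\alpha\, I\|\le 1$. Let $B$ be an unbounded $m$-accretive operator in $H$ having bounded inverse,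 let $\gamma\in(0,1)$, and put $$L=(\operatorname{Re}B^{-1/2})^{-1},\qquad Z=i\,(\operatorname{Re}B^{-1/2})^{-1}\operatorname{Im}B^{-1/2},$$ $$Z_\gamma=\big((I+Z)^\gamma-(I-Z)^\gamma\big)\big((I+Z)^\gamma+(I-Z)^\gamma\big)^{-1},$$ $$B_\gamma=(I+Z_\gamma)^{-1}L^2(I-Z_\gamma^*)^{-1},$$ with products of operators taken on their natural domains. All these objects are well defined: $Z$ is an everywhere defined contraction, and $B^{1/2}$, $\operatorname{Re}B^{-1/2}$, $(I+Z)^\gamma+(I-Z)^\gamma$, $I+Z_\gamma$ and $I-Z_\gamma^*$ are injective. Moreover: 1. $Z_\gamma\in C_H(\pi\gamma/2)$, and for every $f\in\operatorname{dom}L$ one has $Z_\gamma^*f\in\operatorname{dom}L$ and $LZ_\gamma^*f=-Z_\gamma Lf$. 2. $B_\gamma=L\big((I+Z_\gamma)(I-Z_\gamma^*)\big)^{-1}L$, the operator $B_\gamma$ is $m$-$\frac{\pi\gamma}{2}$-sectorial, and $$B_\gamma^{1/2}=(I+Z_\gamma)^{-1}L=L(I-Z_\gamma^*)^{-1}.$$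 3. $\operatorname{dom}B^{1/2}=\operatorname{dom}B^{*1/2}$ if and only if $\operatorname{dom}B_\gamma^{1/2}=\operatorname{dom}B_\gamma^{*1/2}$. -/

import Mathlib

open scoped InnerProductSpace

namespace LinearPMap

noncomputable section

variable {H : Type*} [NormedAddCommGroup H] [InnerProductSpace ℂ H]

/-- The product `S R` of two partially defined operators with its natural domain
`{x ∈ dom R | R x ∈ dom S}`. -/
def pcomp (S R : H →ₗ.[ℂ] H) : H →ₗ.[ℂ] H where
  domain := (S.domain.comap R.toFun).map R.domain.subtype
  toFun :=
    { toFun := fun x => S ⟨R ⟨x, by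
          obtain ⟨y, _, hy⟩ := x.2; exact hy ▸ y.2⟩, by
          obtain ⟨y, hy, hyx⟩ := x.2
          have h : y = ⟨(x : H), hyx ▸ y.2⟩ := Subtype.ext hyx
          exact h ▸ hy⟩
      map_add' := fun x y => by
        rw [← S.map_add]; congr 1; apply Subtype.ext; exact R.map_add ⟨x, _⟩ ⟨y, _⟩
      map_smul' := fun c x => by
        rw [RingHom.id_apply, ← S.map_smul]; congr 1; apply Subtype.ext; exact R.map_smul c ⟨x, _⟩ }

infixr:80 " ∘ₚ " => LinearPMap.pcomp

/-- Membership in the graph of a product. -/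
theorem mem_graph_pcomp (S R : H →ₗ.[ℂ] H) (x z : H) :
    (x, z) ∈ (S ∘ₚ R).graph ↔ ∃ y, (x, y) ∈ R.graph ∧ (y, z) ∈ S.graph := by
  constructor
  · intro h
    obtain ⟨⟨w, hw⟩, rfl, rfl⟩ := (mem_graph_iff _).1 h
    obtain ⟨y, hy, hyx⟩ := hw
    have hd : w ∈ R.domain := hyx ▸ y.2
    exact ⟨R ⟨w, hd⟩, R.mem_graph ⟨w, hd⟩, S.mem_graph ⟨R ⟨w, hd⟩, _⟩⟩
  · rintro ⟨y, h1, h2⟩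
    obtain ⟨⟨a, ha⟩, rfl, rfl⟩ := (mem_graph_iff _).1 h1
    obtain ⟨⟨b, hb⟩, h3, rfl⟩ := (mem_graph_iff _).1 h2
    simp only at h3
    subst h3
    exact (mem_graph_iff _).2 ⟨⟨a, ⟨⟨a, ha⟩, hb, rfl⟩⟩, rfl, rfl⟩

variable (H) in
/-- The identity operator `I`, defined on the whole space. -/
def idOp : H →ₗ.[ℂ] H := (LinearMap.id : H →ₗ[ℂ] H).toPMap ⊤

/-- The operator is injective, so that the inverse operator exists. -/
def IsInjective (A : H →ₗ.[ℂ] H) : Prop := ∀ x : A.domain, A x = 0 → (x : H) = 0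

/-- The operator is defined on the whole space and is a contraction. -/
def IsContractionOp (A : H →ₗ.[ℂ] H) : Prop :=
  A.domain = ⊤ ∧ ∀ x : A.domain, ‖A x‖ ≤ ‖(x : H)‖

/-- `A` is unbounded on its domain. -/
def IsUnbounded (A : H →ₗ.[ℂ] H) : Prop :=
  ¬ ∃ C : ℝ, ∀ x : A.domain, ‖A x‖ ≤ C * ‖(x : H)‖

/-- `A` maps its domain bijectively onto the whole space, with bounded inverse. -/
def HasBoundedInverse (A : H →ₗ.[ℂ] H) : Prop :=
  ∃ R : H →L[ℂ] H, (∀ y, (R y, y) ∈ A.graph) ∧ ∀ x : A.domain, R (A x) = x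

/-- The numerical range `W(A) = {(Au, u) | u ∈ dom A, ‖u‖ = 1}`. (Mathlib's inner product
is linear in the second argument.) -/
def numRange (A : H →ₗ.[ℂ] H) : Set ℂ :=
  {z | ∃ u : A.domain, ‖(u : H)‖ = 1 ∧ z = ⟪(u : H), A u⟫_ℂ}

/-- Accretive operators. -/
def IsAccretive (A : H →ₗ.[ℂ] H) : Prop := ∀ z ∈ A.numRange, 0 ≤ z.re

/-- `m`-accretive operators: accretive, densely defined, and `ran (A - λ I)` is the whole space
for some `λ` with negative real part. -/
structure IsMAccretive (A : H →ₗ.[ℂ] H) : Prop where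
  accretive : A.IsAccretive
  dense : Dense (A.domain : Set H)
  range_eq : ∃ l : ℂ, l.re < 0 ∧ ∀ y : H, ∃ x : A.domain, A x - l • (x : H) = y

/-- `α`-sectorial operators (vertex `0`, semi-angle `α`). -/
def IsSectorial (A : H →ₗ.[ℂ] H) (α : ℝ) : Prop := ∀ z ∈ A.numRange, |z.arg| ≤ α

/-- `m`-`α`-sectorial operators. -/
def IsMSectorial (A : H →ₗ.[ℂ] H) (α : ℝ) : Prop := A.IsMAccretive ∧ A.IsSectorial α

/-- The class `C_H(α)`: bounded operators `Z` on the whole space such that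
`‖Z sin α ± i cos α I‖ ≤ 1`. -/
def MemClassC (Z : H →ₗ.[ℂ] H) (α : ℝ) : Prop :=
  ∃ W : H →L[ℂ] H, Z = (W : H →ₗ[ℂ] H).toPMap ⊤ ∧
    ‖(Real.sin α : ℂ) • W + (Complex.I * (Real.cos α : ℂ)) • ContinuousLinearMap.id ℂ H‖ ≤ 1 ∧
    ‖(Real.sin α : ℂ) • W - (Complex.I * (Real.cos α : ℂ)) • ContinuousLinearMap.id ℂ H‖ ≤ 1

/-- The graph of the Balakrishnan operator
`u ↦ (sin γπ / π) ∫₀^∞ t^(γ-1) A (A + t I)⁻¹ u dt`, `u ∈ dom A`. Here `g t = A (A + t I)⁻¹ u`. -/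
def balakrishnanGraph (A : H →ₗ.[ℂ] H) (γ : ℝ) : Submodule ℂ (H × H) where
  carrier := {p | p.1 ∈ A.domain ∧ ∃ g : ℝ → H,
    (∀ t : ℝ, 0 < t → (p.1, g t) ∈ (A ∘ₚ (A + (t : ℂ) • idOp H).inverse).graph) ∧
    MeasureTheory.IntegrableOn (fun t : ℝ => ((t ^ (γ - 1) : ℝ) : ℂ) • g t) (Set.Ioi 0) ∧
    p.2 = ((Real.sin (γ * Real.pi) / Real.pi : ℝ) : ℂ) •
      ∫ t in Set.Ioi (0 : ℝ), ((t ^ (γ - 1) : ℝ) : ℂ) • g t}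
  zero_mem' := ⟨A.domain.zero_mem, fun _ => 0, fun _ _ => Submodule.zero_mem _, by simp, by simp⟩
  add_mem' := by
    rintro p q ⟨hp, g, hg, ig, eg⟩ ⟨hq, h, hh, ih, eh⟩
    refine ⟨A.domain.add_mem hp hq, g + h,
      fun t ht => Submodule.add_mem _ (hg t ht) (hh t ht), ?_, ?_⟩
    · simp only [Pi.add_apply, smul_add]
      exact ig.add ih
    · simp only [Pi.add_apply, smul_add, Prod.snd_add]
      rw [MeasureTheory.integral_add ig ih, smul_add, eg, eh]
  smul_mem' := by
    rintro c p ⟨hp, g, hg, ig, eg⟩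
    refine ⟨A.domain.smul_mem c hp, c • g, fun t ht => Submodule.smul_mem _ c (hg t ht), ?_, ?_⟩
    · simp only [Pi.smul_apply, smul_comm _ c]
      exact ig.smul c
    · simp only [Pi.smul_apply, smul_comm _ c, Prod.smul_snd]
      rw [MeasureTheory.integral_smul, smul_comm, eg]

/-- The graph above is the graph of an operator. -/
theorem balakrishnanGraph_functional (A : H →ₗ.[ℂ] H) (γ : ℝ) (p : H × H)
    (hp : p ∈ A.balakrishnanGraph γ) (h0 : p.1 = 0) : p.2 = 0 := by
  obtain ⟨_, g, hg, _, eg⟩ := hp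
  rw [eg, MeasureTheory.setIntegral_congr_fun (g := fun _ => (0 : H)) measurableSet_Ioi,
    MeasureTheory.integral_zero, smul_zero]
  intro t ht
  have := graph_fst_eq_zero_snd _ (hg t ht) h0
  simp [this]

/-- The fractional power `A ^ γ`, `0 < γ < 1`, of an `m`-accretive operator `A`: the closure of
the Balakrishnan operator on `dom A`. -/
def fracPow (A : H →ₗ.[ℂ] H) (γ : ℝ) : H →ₗ.[ℂ] H :=
  (A.balakrishnanGraph γ).toLinearPMap.closure

/-- The square root `A ^ (1/2)`. -/
def sqrtOp (A : H →ₗ.[ℂ] H) : H →ₗ.[ℂ] H := A.fracPow (1 / 2)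

/-- `B ^ (-1/2)`. -/
def invSqrtOp (B : H →ₗ.[ℂ] H) : H →ₗ.[ℂ] H := B.sqrtOp.inverse

variable [CompleteSpace H]

/-- The real part `(A + A*) / 2` on `dom A ∩ dom A*`. -/
def reOp (A : H →ₗ.[ℂ] H) : H →ₗ.[ℂ] H := (1 / 2 : ℂ) • (A + A.adjoint)

/-- The imaginary part `(A - A*) / (2i)` on `dom A ∩ dom A*`. -/
def imOp (A : H →ₗ.[ℂ] H) : H →ₗ.[ℂ] H := (1 / (2 * Complex.I)) • (A - A.adjoint)

/-- `L = (Re B^(-1/2))⁻¹`. -/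
def katoL (B : H →ₗ.[ℂ] H) : H →ₗ.[ℂ] H := B.invSqrtOp.reOp.inverse

/-- `Z = i (Re B^(-1/2))⁻¹ (Im B^(-1/2))`. -/
def katoZ (B : H →ₗ.[ℂ] H) : H →ₗ.[ℂ] H :=
  Complex.I • (B.invSqrtOp.reOp.inverse ∘ₚ B.invSqrtOp.imOp)

/-- `Z_γ = ((I+Z)^γ - (I-Z)^γ) ((I+Z)^γ + (I-Z)^γ)⁻¹`. -/
def katoZPow (B : H →ₗ.[ℂ] H) (γ : ℝ) : H →ₗ.[ℂ] H :=
  ((idOp H + B.katoZ).fracPow γ - (idOp H - B.katoZ).fracPow γ) ∘ₚ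
    ((idOp H + B.katoZ).fracPow γ + (idOp H - B.katoZ).fracPow γ).inverse

/-- `B_γ = (I + Z_γ)⁻¹ L² (I - Z_γ*)⁻¹`. -/
def katoB (B : H →ₗ.[ℂ] H) (γ : ℝ) : H →ₗ.[ℂ] H :=
  (idOp H + B.katoZPow γ).inverse ∘ₚ (B.katoL ∘ₚ B.katoL) ∘ₚ
    (idOp H - (B.katoZPow γ).adjoint).inverse

end

end LinearPMap

/-! The inverse `R` of `B` is a bounded injective accretive operator, so every unbounded operator in
the statement is the inverse of an injective bounded one, and the theorem becomes one about bounded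
operators. Let `S = R^(1/2)` and `X = Re S`. Then `B^(1/2) = S⁻¹`, and `Re (S² u, u) ≥ 0` says that
the skew part of `S` is dominated in norm by `X`. Hence `S = X (1 + Z)` and `S* = X (1 - Z)` with a
contraction `Z` satisfying `Z* X = -X Z` (`exists_katoPair`).

The relation `Z* X = -X Z` says that `X` intertwines `1 ± Z` with `1 ∓ Z*`. Balakrishnan's integral
preserves intertwining, so `Z_γ` satisfies the same relation. Consequently `T = X (1 + Z_γ)` has
real part `X` and adjoint `X (1 - Z_γ)`, and `B_γ = T⁻²`. Both `T` and `T²` are accretive, so by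
uniqueness of the accretive root `T` is the square root of `T²`; this gives the formulas for
`B_γ^(1/2)`.

The angle comes from the pairing of `(1 - Z)^γ u` with `(1 + Z)^γ u`, whose values lie in the sector
`|arg| ≤ πγ/2`. Formally `(1 + Z)^γ = C^γ (1 - Z)^γ` for the accretive Cayley transform `C = (1 +
Z)(1 - Z)⁻¹`. To get a sharp half-plane one uses `-iC`, whose numerical range lies in the lower
half-plane, as does that of its `γ`-th power; the phase `exp(-iγπ/2)` then rotates the half-plane.
This product rule is proved for strict contractions by solving a linear differential equation along
a curve from `1` to `-iC` (`fpow_cayley_mul`), and passes to contractions by continuity. Applying it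
to `Z` and `-Z` gives the sector, which is the condition `Z_γ ∈ C(πγ/2)` and in turn the
sectoriality of `T²`.

For the domains: `X (1 + Z)` and `X (1 - Z)` have equal ranges exactly when `1 + Z` and `1 - Z` are
both invertible (`KatoPair.range_eq_iff`). Since `1 ± Z_γ` is twice `(1 ± Z)^γ` times an invertible
operator, and an accretive operator is invertible exactly when its `γ`-th power is, the condition is
the same for `Z` and `Z_γ`. -/

noncomputable section

namespace FractionalPower

open MeasureTheory Set Filter Topology

section

/-! ### The scalar weight of Balakrishnan's integral. -/

section Scalar

/-- The weight `t ^ (γ - 1) / (1 + t)` is integrable on the half-line. -/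
theorem integrableOn_weight {γ : ℝ} (h0 : 0 < γ) (h1 : γ < 1) :
    IntegrableOn (fun t : ℝ => t ^ (γ - 1) * (1 + t)⁻¹) (Ioi 0) := by
  have hc : ContinuousOn (fun t : ℝ => t ^ (γ - 1) * (1 + t)⁻¹) (Ioi 0) := by
    refine ContinuousOn.mul (fun t ht => ?_) (ContinuousOn.inv₀ (by fun_prop) fun t ht => ?_)
    · exact (Real.continuousAt_rpow_const t _ (Or.inl (ne_of_gt ht))).continuousWithinAt
    · have : (0 : ℝ) < t := ht
      positivity
  rw [← Ioc_union_Ioi_eq_Ioi (zero_le_one (α := ℝ))]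
  refine IntegrableOn.union ?_ ?_
  · have h := (intervalIntegral.intervalIntegrable_rpow' (a := 0) (b := 1)
      (by linarith : -1 < γ - 1)).1
    refine Integrable.mono' h ((hc.mono Ioc_subset_Ioi_self).aestronglyMeasurable
      measurableSet_Ioc) ((ae_restrict_iff' measurableSet_Ioc).2 (.of_forall fun t ht => ?_))
    have ht0 : 0 < t := ht.1
    rw [Real.norm_of_nonneg (by positivity)]
    exact mul_le_of_le_one_right (by positivity) (inv_le_one_of_one_le₀ (by linarith))
  · have h := integrableOn_Ioi_rpow_of_lt (by linarith : γ - 2 < -1) one_pos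
    refine Integrable.mono' h ((hc.mono (Ioi_subset_Ioi zero_le_one)).aestronglyMeasurable
      measurableSet_Ioi) ((ae_restrict_iff' measurableSet_Ioi).2 (.of_forall fun t ht => ?_))
    have ht0 : 0 < t := one_pos.trans ht
    rw [Real.norm_of_nonneg (by positivity), show γ - 1 = γ - 2 + 1 by ring,
      Real.rpow_add_one ht0.ne', mul_assoc]
    refine mul_le_of_le_one_right (by positivity) ?_
    rw [← div_eq_mul_inv, div_le_one (by positivity)]
    linarith

/-- The substitution `t = x²` reduces this to the arctangent integral. The exact value is needed
only for the exponent `1/2`, to normalize square roots. -/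
theorem integral_weight_half :
    ∫ t in Ioi (0 : ℝ), t ^ ((1 / 2 : ℝ) - 1) * (1 + t)⁻¹ = Real.pi := by
  rw [← integral_comp_rpow_Ioi_of_pos two_pos]
  have : ∀ x ∈ Ioi (0 : ℝ), (2 * x ^ ((2 : ℝ) - 1)) • ((x ^ (2 : ℝ)) ^ ((1 / 2 : ℝ) - 1) *
      (1 + x ^ (2 : ℝ))⁻¹) = 2 * (1 + x ^ 2)⁻¹ := by
    intro x hx
    have hx : 0 < x := hx
    rw [← Real.rpow_mul hx.le, smul_eq_mul, ← mul_assoc, mul_assoc 2, ← Real.rpow_add hx,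
      Real.rpow_two]
    norm_num
  rw [setIntegral_congr_fun measurableSet_Ioi this, integral_const_mul,
    integral_Ioi_inv_one_add_sq, Real.arctan_zero]
  ring

theorem sin_mul_pi_div_pi_pos {γ : ℝ} (h0 : 0 < γ) (h1 : γ < 1) :
    0 < Real.sin (γ * Real.pi) / Real.pi :=
  div_pos (Real.sin_pos_of_pos_of_lt_pi (by positivity)
    (by nlinarith [Real.pi_pos])) Real.pi_pos

end Scalar

/-! ### Fractional powers in a Banach algebra. -/

section Algebra

variable {𝔸 : Type*} [NormedRing 𝔸] [NormedAlgebra ℂ 𝔸]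

/-- The resolvent estimate `‖(A + t)⁻¹‖ ≤ M / t` for `t > 0`. -/
structure Nonneg (A : 𝔸) (M : ℝ) : Prop where
  isUnit : ∀ t : ℝ, 0 < t → IsUnit (A + (t : ℂ) • 1)
  norm_le : ∀ t : ℝ, 0 < t → ‖Ring.inverse (A + (t : ℂ) • 1)‖ ≤ M / t

/-- The resolvent estimate `‖(A + t)⁻¹‖ ≤ M / (1 + t)` for `t ≥ 0`. -/
structure Positive (A : 𝔸) (M : ℝ) : Prop where
  isUnit : ∀ t : ℝ, 0 ≤ t → IsUnit (A + (t : ℂ) • 1)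
  norm_le : ∀ t : ℝ, 0 ≤ t → ‖Ring.inverse (A + (t : ℂ) • 1)‖ ≤ M / (1 + t)

theorem Positive.bound_nonneg {A : 𝔸} {M : ℝ} (h : Positive A M) : 0 ≤ M := by
  simpa using (norm_nonneg _).trans (h.norm_le 0 le_rfl)

theorem Positive.nonneg {A : 𝔸} {M : ℝ} (h : Positive A M) : Nonneg A M :=
  ⟨fun t ht => h.isUnit t ht.le, fun t ht => (h.norm_le t ht.le).trans
    (div_le_div_of_nonneg_left h.bound_nonneg ht (by linarith))⟩

/-- The bounded transform `A (A + t)⁻¹`. -/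
def yosida (A : 𝔸) (t : ℝ) : 𝔸 := A * Ring.inverse (A + (t : ℂ) • 1)

theorem yosida_eq {A : 𝔸} {t : ℝ} (h : IsUnit (A + (t : ℂ) • 1)) :
    yosida A t = 1 - (t : ℂ) • Ring.inverse (A + (t : ℂ) • 1) := by
  rw [eq_sub_iff_add_eq, yosida, ← one_mul (Ring.inverse _), ← smul_mul_assoc, one_mul, ← add_mul,
    Ring.mul_inverse_cancel _ h]

/-- Adds a uniform bound, from `1 - t (A + t)⁻¹`, to a bound of order `1 / t`, from `A (A + t)⁻¹`.
The resulting decay makes the kernel integrable both at `0` and at infinity. -/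
theorem Nonneg.norm_yosida_le {A : 𝔸} {M : ℝ} (h : Nonneg A M) {t : ℝ} (ht : 0 < t) :
    ‖yosida A t‖ ≤ (‖(1 : 𝔸)‖ + M + ‖A‖ * M) * (1 + t)⁻¹ := by
  have h1 : ‖yosida A t‖ ≤ ‖(1 : 𝔸)‖ + M := by
    rw [yosida_eq (h.isUnit t ht)]
    refine (norm_sub_le _ _).trans (add_le_add_right ?_ _)
    rw [norm_smul, Complex.norm_real, Real.norm_of_nonneg ht.le]
    exact (mul_le_mul_of_nonneg_left (h.norm_le t ht) ht.le).trans_eq (by field_simp)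
  have h2 : t * ‖yosida A t‖ ≤ ‖A‖ * M := by
    have := (norm_mul_le A (Ring.inverse (A + (t : ℂ) • 1))).trans
      (mul_le_mul_of_nonneg_left (h.norm_le t ht) (norm_nonneg _))
    exact (mul_le_mul_of_nonneg_left this ht.le).trans_eq (by field_simp)
  rw [← div_eq_mul_inv, le_div_iff₀ (by linarith)]
  linarith

theorem commute_ringInverse_right {R : Type*} [MonoidWithZero R] {a b : R} (h : Commute a b) :
    Commute a (Ring.inverse b) := by
  by_cases hb : IsUnit b
  · obtain ⟨u, rfl⟩ := hb
    rw [Ring.inverse_unit]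
    exact h.units_inv_right
  · rw [Ring.inverse_non_unit _ hb]
    exact Commute.zero_right a

theorem yosida_mul_of_mul_eq {A B V : 𝔸} {t : ℝ} (hA : IsUnit (A + (t : ℂ) • 1))
    (hB : IsUnit (B + (t : ℂ) • 1)) (h : A * V = V * B) : yosida A t * V = V * yosida B t := by
  have h1 : (A + (t : ℂ) • 1) * V = V * (B + (t : ℂ) • 1) := by
    simp [add_mul, mul_add, h]
  have h2 : Ring.inverse (A + (t : ℂ) • 1) * V = V * Ring.inverse (B + (t : ℂ) • 1) := by
    rw [Ring.inverse_mul_eq_iff_eq_mul _ _ _ hA, ← mul_assoc,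
      Ring.eq_mul_inverse_iff_mul_eq _ _ _ hB, ← h1]
  rw [yosida_eq hA, yosida_eq hB, sub_mul, mul_sub, one_mul, mul_one, smul_mul_assoc, h2,
    mul_smul_comm]

theorem continuousOn_rpow_cast (s : ℝ) :
    ContinuousOn (fun t : ℝ => ((t ^ s : ℝ) : ℂ)) (Ioi 0) := fun t ht =>
  (Complex.continuous_ofReal.continuousAt.comp
    (Real.continuousAt_rpow_const t _ (Or.inl (ne_of_gt ht)))).continuousWithinAt

theorem aestronglyMeasurable_kernel (s : ℝ) {f : ℝ → 𝔸} (hf : ContinuousOn f (Ioi 0)) :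
    AEStronglyMeasurable (fun t : ℝ => ((t ^ s : ℝ) : ℂ) • f t) (volume.restrict (Ioi 0)) :=
  ((continuousOn_rpow_cast s).smul hf).aestronglyMeasurable measurableSet_Ioi

theorem norm_kernel_le (s : ℝ) {x : 𝔸} {t c : ℝ} (ht : 0 < t) (hx : ‖x‖ ≤ c * (1 + t)⁻¹) :
    ‖((t ^ s : ℝ) : ℂ) • x‖ ≤ c * (t ^ s * (1 + t)⁻¹) := by
  rw [norm_smul, Complex.norm_real, Real.norm_of_nonneg (by positivity)]
  exact (mul_le_mul_of_nonneg_left hx (by positivity)).trans_eq (by ring)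

variable [CompleteSpace 𝔸]

theorem hasDerivAt_ringInverse {a : ℝ → 𝔸} {a' : 𝔸} {r : ℝ} (ha : HasDerivAt a a' r)
    (hu : IsUnit (a r)) : HasDerivAt (fun r => Ring.inverse (a r))
      (-(Ring.inverse (a r) * a' * Ring.inverse (a r))) r := by
  obtain ⟨u, hu⟩ := hu
  have h := hasFDerivAt_ringInverse (𝕜 := ℝ) u
  rw [hu] at h
  have h2 := h.comp_hasDerivAt r ha
  rw [← hu, Ring.inverse_unit]
  simpa [Function.comp_def] using h2

theorem hasDerivAt_resolvent {A : 𝔸} {t : ℝ} (hu : IsUnit (A + (t : ℂ) • 1)) :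
    HasDerivAt (fun t : ℝ => Ring.inverse (A + (t : ℂ) • 1))
      (-(Ring.inverse (A + (t : ℂ) • 1) * Ring.inverse (A + (t : ℂ) • 1))) t := by
  have h : HasDerivAt (fun t : ℝ => A + (t : ℂ) • (1 : 𝔸)) 1 t := by
    simpa using ((Complex.ofRealCLM.hasDerivAt (x := t)).smul_const (1 : 𝔸)).const_add A
  simpa using hasDerivAt_ringInverse h hu

theorem Nonneg.continuousOn_yosida {A : 𝔸} {M : ℝ} (h : Nonneg A M) :
    ContinuousOn (yosida A) (Ioi 0) := fun t ht =>
  (continuousAt_const.mul (hasDerivAt_resolvent (h.isUnit t ht)).continuousAt).continuousWithinAt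

variable {γ : ℝ}

omit [CompleteSpace 𝔸] in
theorem integrableOn_kernel (h0 : 0 < γ) (h1 : γ < 1) {f : ℝ → 𝔸} {c : ℝ}
    (hf : ContinuousOn f (Ioi 0)) (hc : ∀ t, 0 < t → ‖f t‖ ≤ c * (1 + t)⁻¹) :
    IntegrableOn (fun t : ℝ => ((t ^ (γ - 1) : ℝ) : ℂ) • f t) (Ioi 0) :=
  Integrable.mono' ((integrableOn_weight h0 h1).const_mul c) (aestronglyMeasurable_kernel _ hf)
    ((ae_restrict_iff' measurableSet_Ioi).2 (.of_forall fun t ht => norm_kernel_le _ ht (hc t ht)))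

theorem Nonneg.integrableOn {A : 𝔸} {M : ℝ} (h : Nonneg A M) (h0 : 0 < γ) (h1 : γ < 1) :
    IntegrableOn (fun t : ℝ => ((t ^ (γ - 1) : ℝ) : ℂ) • yosida A t) (Ioi 0) :=
  integrableOn_kernel h0 h1 h.continuousOn_yosida fun _ => h.norm_yosida_le

/-- The fractional power of an element of a Banach algebra, given by Balakrishnan's formula. -/
def fpow (γ : ℝ) (A : 𝔸) : 𝔸 := ((Real.sin (γ * Real.pi) / Real.pi : ℝ) : ℂ) •
  ∫ t in Ioi (0 : ℝ), ((t ^ (γ - 1) : ℝ) : ℂ) • yosida A t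

/-- An intertwiner passes to the resolvents and then through the integral. The case `A ≠ B` is what
transports `Z* X = -X Z` to fractional powers; `A = B` gives commutation. -/
theorem fpow_mul_of_mul_eq (h0 : 0 < γ) (h1 : γ < 1) {A B V : 𝔸} {M N : ℝ} (hA : Nonneg A M)
    (hB : Nonneg B N) (h : A * V = V * B) : fpow γ A * V = V * fpow γ B := by
  have e1 := ((ContinuousLinearMap.mul ℂ 𝔸).flip V).integral_comp_comm (hA.integrableOn h0 h1)
  have e2 := (ContinuousLinearMap.mul ℂ 𝔸 V).integral_comp_comm (hB.integrableOn h0 h1)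
  simp only [ContinuousLinearMap.flip_apply, ContinuousLinearMap.mul_apply'] at e1 e2
  rw [fpow, fpow, smul_mul_assoc, mul_smul_comm, ← e1, ← e2]
  congr 1
  refine setIntegral_congr_fun measurableSet_Ioi fun t ht => ?_
  simp only [smul_mul_assoc, mul_smul_comm,
    yosida_mul_of_mul_eq (hA.isUnit t ht) (hB.isUnit t ht) h]

theorem commute_fpow (h0 : 0 < γ) (h1 : γ < 1) {A V : 𝔸} {M : ℝ} (hA : Nonneg A M)
    (h : Commute V A) : Commute V (fpow γ A) :=
  (fpow_mul_of_mul_eq h0 h1 hA hA h.symm.eq).symm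

/-- Dominated convergence; the constants `M` and `K` uniform along the family give the integrable
majorant. -/
theorem tendsto_fpow {ι : Type*} {l : Filter ι} [l.IsCountablyGenerated] (h0 : 0 < γ)
    (h1 : γ < 1) {A : ι → 𝔸} {A₀ : 𝔸} {M K : ℝ} (hA : ∀ i, Nonneg (A i) M) (hK : ∀ i, ‖A i‖ ≤ K)
    (hA₀ : Nonneg A₀ M) (h : Tendsto A l (𝓝 A₀)) :
    Tendsto (fun i => fpow γ (A i)) l (𝓝 (fpow γ A₀)) := by
  have hM : 0 ≤ M := by simpa using (norm_nonneg _).trans (hA₀.norm_le 1 one_pos)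
  refine Tendsto.const_smul (tendsto_integral_filter_of_dominated_convergence
    (fun t => (‖(1 : 𝔸)‖ + M + K * M) * (t ^ (γ - 1) * (1 + t)⁻¹))
    (.of_forall fun i => ((hA i).integrableOn h0 h1).aestronglyMeasurable) ?_
    ((integrableOn_weight h0 h1).const_mul _) ?_) _
  · refine .of_forall fun i => (ae_restrict_iff' measurableSet_Ioi).2 (.of_forall fun t ht => ?_)
    have ht : 0 < t := ht
    refine norm_kernel_le _ ht (((hA i).norm_yosida_le ht).trans ?_)
    have := hK i
    gcongr
  · refine (ae_restrict_iff' measurableSet_Ioi).2 (.of_forall fun t ht => ?_)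
    refine Tendsto.const_smul (h.mul ?_) _
    obtain ⟨u, hu⟩ := hA₀.isUnit t ht
    have := (NormedRing.inverse_continuousAt u).tendsto
    rw [hu] at this
    exact this.comp (h.add_const _)

omit [CompleteSpace 𝔸] in
theorem Positive.norm_resolvent_sq_le {A : 𝔸} {M : ℝ} (hA : Positive A M) {t : ℝ} (ht : 0 < t) :
    ‖(t : ℂ) • (Ring.inverse (A + (t : ℂ) • 1) * Ring.inverse (A + (t : ℂ) • 1))‖ ≤
      M * M * (1 + t)⁻¹ := by
  have h := hA.norm_le t ht.le
  have hM := hA.bound_nonneg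
  rw [norm_smul, Complex.norm_real, Real.norm_of_nonneg ht.le]
  calc _ ≤ t * (M / (1 + t) * (M / (1 + t))) := by
        gcongr
        exact (norm_mul_le _ _).trans (by gcongr)
    _ = M * M * (1 + t)⁻¹ * (t / (1 + t)) := by field_simp
    _ ≤ _ := mul_le_of_le_one_right (by positivity) ((div_le_one (by positivity)).2 (by linarith))

omit [CompleteSpace 𝔸] in
theorem rpow_smul_eq {t : ℝ} (ht : 0 < t) (x : 𝔸) :
    ((t ^ γ : ℝ) : ℂ) • x = ((t ^ (γ - 1) : ℝ) : ℂ) • (t : ℂ) • x := by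
  rw [smul_smul, ← Complex.ofReal_mul, ← Real.rpow_add_one ht.ne', sub_add_cancel]

theorem Positive.continuousOn_resolvent {A : 𝔸} {M : ℝ} (hA : Positive A M) :
    ContinuousOn (fun t : ℝ => Ring.inverse (A + (t : ℂ) • 1)) (Ici 0) := fun t ht =>
  (hasDerivAt_resolvent (hA.isUnit t ht)).continuousAt.continuousWithinAt

theorem Positive.integrableOn_resolvent_sq (h0 : 0 < γ) (h1 : γ < 1) {A : 𝔸} {M : ℝ}
    (hA : Positive A M) : IntegrableOn (fun t : ℝ => ((t ^ γ : ℝ) : ℂ) •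
      (Ring.inverse (A + (t : ℂ) • 1) * Ring.inverse (A + (t : ℂ) • 1))) (Ioi 0) := by
  have hc := hA.continuousOn_resolvent.mono Ioi_subset_Ici_self
  exact (integrableOn_kernel h0 h1 (Complex.continuous_ofReal.continuousOn.smul (hc.mul hc))
    fun t ht => hA.norm_resolvent_sq_le ht).congr_fun (fun t ht => (rpow_smul_eq ht _).symm)
      measurableSet_Ioi

theorem Positive.integrableOn_resolvent (h0 : 0 < γ) (h1 : γ < 1) {A : 𝔸} {M : ℝ}
    (hA : Positive A M) : IntegrableOn (fun t : ℝ => ((t ^ (γ - 1) : ℝ) : ℂ) •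
      Ring.inverse (A + (t : ℂ) • 1)) (Ioi 0) :=
  integrableOn_kernel h0 h1 (hA.continuousOn_resolvent.mono Ioi_subset_Ici_self)
    fun t ht => (hA.norm_le t ht.le).trans_eq (div_eq_mul_inv _ _)

/-- Integration by parts: `t^γ (A + t)⁻¹` vanishes at `0` and at infinity, and its derivative
consists of the two integrands, since `A⁻¹ · A (A + t)⁻¹ = (A + t)⁻¹`. -/
theorem Positive.integral_resolvent_sq (h0 : 0 < γ) (h1 : γ < 1) {A : 𝔸} {M : ℝ}
    (hA : Positive A M) :
    ∫ t in Ioi (0 : ℝ), ((t ^ γ : ℝ) : ℂ) • (Ring.inverse (A + (t : ℂ) • 1) *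
      Ring.inverse (A + (t : ℂ) • 1)) = (γ : ℂ) • (Ring.inverse A *
        ∫ t in Ioi (0 : ℝ), ((t ^ (γ - 1) : ℝ) : ℂ) • yosida A t) := by
  have hi1 := hA.integrableOn_resolvent h0 h1
  have hi2 := hA.integrableOn_resolvent_sq h0 h1
  have hM := hA.bound_nonneg
  have hu : IsUnit A := by simpa using hA.isUnit 0 le_rfl
  have hcont : ContinuousWithinAt (fun t : ℝ => ((t ^ γ : ℝ) : ℂ) •
      Ring.inverse (A + (t : ℂ) • 1)) (Ici 0) 0 :=
    (Complex.continuous_ofReal.continuousAt.comp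
      (Real.continuousAt_rpow_const 0 _ (Or.inr h0.le))).continuousWithinAt.smul
      (hA.continuousOn_resolvent 0 (by simp))
  have hder : ∀ t ∈ Ioi (0 : ℝ), HasDerivAt (fun t : ℝ => ((t ^ γ : ℝ) : ℂ) •
      Ring.inverse (A + (t : ℂ) • 1)) ((γ : ℂ) • (((t ^ (γ - 1) : ℝ) : ℂ) •
      Ring.inverse (A + (t : ℂ) • 1)) - ((t ^ γ : ℝ) : ℂ) • (Ring.inverse (A + (t : ℂ) • 1) *
      Ring.inverse (A + (t : ℂ) • 1))) t := by
    intro t ht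
    have e := ((Real.hasDerivAt_rpow_const (p := γ) (Or.inl (ne_of_gt ht))).ofReal_comp).smul
      (hasDerivAt_resolvent (hA.isUnit t (le_of_lt ht)))
    refine e.congr_deriv ?_
    rw [smul_neg, Complex.ofReal_mul, mul_smul]
    abel
  have hlim : Tendsto (fun t : ℝ => ((t ^ γ : ℝ) : ℂ) • Ring.inverse (A + (t : ℂ) • 1)) atTop
      (𝓝 0) := by
    refine squeeze_zero_norm' (a := fun t : ℝ => M * t ^ (γ - 1)) ?_ ?_
    · filter_upwards [eventually_gt_atTop 0] with t ht
      rw [norm_smul, Complex.norm_real, Real.norm_of_nonneg (by positivity)]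
      calc _ ≤ t ^ γ * (M / t) := by
            gcongr
            exact (hA.norm_le t ht.le).trans (by gcongr; linarith)
        _ = M * t ^ (γ - 1) := by rw [Real.rpow_sub_one ht.ne']; ring
    · have := (tendsto_rpow_neg_atTop (by linarith : 0 < 1 - γ)).const_mul M
      simpa using this
  have hi3 : IntegrableOn (fun t : ℝ => (γ : ℂ) • (((t ^ (γ - 1) : ℝ) : ℂ) •
      Ring.inverse (A + (t : ℂ) • 1))) (Ioi 0) := hi1.smul (γ : ℂ)
  have key := integral_Ioi_of_hasDerivAt_of_tendsto hcont hder (hi3.sub hi2) hlim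
  rw [integral_sub hi3 hi2, integral_smul, Real.zero_rpow h0.ne', Complex.ofReal_zero,
    zero_smul, sub_zero, sub_eq_zero] at key
  rw [← key]
  congr 1
  have e2 := (ContinuousLinearMap.mul ℂ 𝔸 (Ring.inverse A)).integral_comp_comm
    (hA.nonneg.integrableOn h0 h1)
  simp only [ContinuousLinearMap.mul_apply'] at e2
  rw [← e2]
  refine setIntegral_congr_fun measurableSet_Ioi fun t ht => ?_
  simp only [mul_smul_comm, yosida, Ring.inverse_mul_cancel_left _ _ hu]

/-- Along a commuting curve of strictly positive elements, fractional powers satisfy the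
differential equation `(A ^ γ)' = γ A' A⁻¹ A ^ γ`. -/
theorem hasDerivAt_fpow (h0 : 0 < γ) (h1 : γ < 1) {A A' : ℝ → 𝔸} {M K : ℝ}
    (hA : ∀ r, Positive (A r) M) (hd : ∀ r, HasDerivAt A (A' r) r) (hK : ∀ r, ‖A' r‖ ≤ K)
    (hc : ∀ r, Commute (A r) (A' r)) (r : ℝ) :
    HasDerivAt (fun r => fpow γ (A r))
      (((γ : ℂ) • (A' r * Ring.inverse (A r))) * fpow γ (A r)) r := by
  have hK0 : 0 ≤ K := (norm_nonneg _).trans (hK r)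
  have hpt : ∀ t, 0 < t → ∀ r, HasDerivAt (fun r => ((t ^ (γ - 1) : ℝ) : ℂ) • yosida (A r) t)
      (A' r * (((t ^ γ : ℝ) : ℂ) • (Ring.inverse (A r + (t : ℂ) • 1) *
        Ring.inverse (A r + (t : ℂ) • 1)))) r := by
    intro t ht r
    -- Differentiating `1 - t (A r + t)⁻¹` leaves `A' r` between two resolvents; commutation moves
    -- it to the front, out of the integral.
    have hcomm : Commute (A r + (t : ℂ) • 1) (A' r) :=
      (hc r).add_left ((Commute.one_left _).smul_left _)
    have e := ((((hasDerivAt_ringInverse ((hd r).add_const ((t : ℂ) • (1 : 𝔸)))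
      ((hA r).isUnit t ht.le)).const_smul (t : ℂ)).const_sub 1).const_smul
      ((t ^ (γ - 1) : ℝ) : ℂ))
    refine (e.congr_of_eventuallyEq (.of_forall fun s => ?_)).congr_deriv ?_
    · simp only [yosida_eq ((hA s).isUnit t ht.le)]; rfl
    · rw [rpow_smul_eq (γ := γ) ht]
      simp only [smul_neg, neg_neg, mul_smul_comm]
      rw [← mul_assoc, (commute_ringInverse_right hcomm.symm).eq]
  have hderiv := (hasDerivAt_integral_of_dominated_loc_of_deriv_le (𝕜 := ℝ) (x₀ := r)
    (μ := volume.restrict (Ioi 0)) (F := fun r t => ((t ^ (γ - 1) : ℝ) : ℂ) • yosida (A r) t)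
    (F' := fun r t => A' r * (((t ^ γ : ℝ) : ℂ) • (Ring.inverse (A r + (t : ℂ) • 1) *
        Ring.inverse (A r + (t : ℂ) • 1))))
    (bound := fun t => K * (M * M * (t ^ (γ - 1) * (1 + t)⁻¹))) univ_mem
    (.of_forall fun s => ((hA s).nonneg.integrableOn h0 h1).aestronglyMeasurable)
    ((hA r).nonneg.integrableOn h0 h1)
    (((hA r).integrableOn_resolvent_sq h0 h1).aestronglyMeasurable.const_mul _)
    ((ae_restrict_iff' measurableSet_Ioi).2 (.of_forall fun t ht s _ => ?_))
    (((integrableOn_weight h0 h1).const_mul _).const_mul _)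
    ((ae_restrict_iff' measurableSet_Ioi).2 (.of_forall fun t ht s _ => hpt t ht s))).2
  · have e2 := (ContinuousLinearMap.mul ℂ 𝔸 (A' r)).integral_comp_comm
      ((hA r).integrableOn_resolvent_sq h0 h1)
    simp only [ContinuousLinearMap.mul_apply'] at e2
    rw [e2, (hA r).integral_resolvent_sq h0 h1] at hderiv
    refine (hderiv.const_smul ((Real.sin (γ * Real.pi) / Real.pi : ℝ) : ℂ)).congr_deriv ?_
    rw [fpow, mul_smul_comm, mul_smul_comm, smul_mul_assoc, mul_assoc]
  · refine (norm_mul_le _ _).trans (mul_le_mul (hK s) ?_ (norm_nonneg _) hK0)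
    rw [rpow_smul_eq ht]
    exact norm_kernel_le _ ht ((hA s).norm_resolvent_sq_le ht)

omit [CompleteSpace 𝔸] in
/-- Solutions of the linear equation `E' = G E` with bounded `G` are determined by one value. -/
theorem eq_of_hasDerivAt_mul {E F G : ℝ → 𝔸} {K : ℝ} (hG : ∀ r, ‖G r‖ ≤ K)
    (hE : ∀ r, HasDerivAt E (G r * E r) r) (hF : ∀ r, HasDerivAt F (G r * F r) r)
    (h : E 0 = F 0) : E = F := by
  refine ODE_solution_unique_univ (v := fun r x => G r * x) (s := fun _ => univ)
    (K := K.toNNReal) (fun t => (LipschitzWith.of_dist_le_mul fun x y => ?_).lipschitzOnWith)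
    (fun t => ⟨hE t, mem_univ _⟩) (fun t => ⟨hF t, mem_univ _⟩) h
  rw [dist_eq_norm, dist_eq_norm, ← mul_sub, Real.coe_toNNReal _ ((norm_nonneg _).trans (hG t))]
  exact (norm_mul_le _ _).trans (mul_le_mul_of_nonneg_right (hG t) (norm_nonneg _))

omit [CompleteSpace 𝔸] in
theorem yosida_one {t : ℝ} (ht : 0 < t) : yosida (1 : 𝔸) t = (((1 + t)⁻¹ : ℝ) : ℂ) • 1 := by
  have h : (1 : 𝔸) + (t : ℂ) • 1 = ((1 + t : ℝ) : ℂ) • 1 := by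
    rw [Complex.ofReal_add, add_smul, Complex.ofReal_one, one_smul]
  have h0 : ((1 + t : ℝ) : ℂ) ≠ 0 := Complex.ofReal_ne_zero.2 (by positivity)
  have hu : IsUnit (((1 + t : ℝ) : ℂ) • (1 : 𝔸)) := by
    rw [← Algebra.algebraMap_eq_smul_one]
    exact (IsUnit.mk0 _ h0).map _
  rw [yosida, h, one_mul, ← mul_one (Ring.inverse _), Ring.inverse_mul_eq_iff_eq_mul _ _ _ hu,
    smul_mul_smul_comm, Complex.ofReal_inv, mul_inv_cancel₀ h0, one_smul, one_mul]

theorem fpow_one (γ : ℝ) : fpow γ (1 : 𝔸) = ((Real.sin (γ * Real.pi) / Real.pi *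
    ∫ t in Ioi (0 : ℝ), t ^ (γ - 1) * (1 + t)⁻¹ : ℝ) : ℂ) • 1 := by
  rw [fpow, Complex.ofReal_mul, mul_smul]
  congr 1
  rw [← integral_complex_ofReal, ← integral_smul_const]
  refine setIntegral_congr_fun measurableSet_Ioi fun t ht => ?_
  simp only [yosida_one ht, smul_smul, Complex.ofReal_mul]

theorem fpow_half_one : fpow (1 / 2) (1 : 𝔸) = 1 := by
  rw [fpow_one, integral_weight_half, show (1 / 2 * Real.pi) = Real.pi / 2 by ring,
    Real.sin_pi_div_two, div_mul_cancel₀ _ Real.pi_ne_zero, Complex.ofReal_one, one_smul]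

/-- For general `γ` only the positivity of this scalar is used, so its value is not computed. -/
theorem exists_fpow_one_eq (h0 : 0 < γ) (h1 : γ < 1) :
    ∃ κ : ℝ, 0 < κ ∧ fpow γ (1 : 𝔸) = (κ : ℂ) • 1 := by
  refine ⟨_, mul_pos (sin_mul_pi_div_pi_pos h0 h1) ?_, fpow_one γ⟩
  rw [setIntegral_pos_iff_support_of_nonneg_ae ((ae_restrict_iff' measurableSet_Ioi).2
    (.of_forall fun t ht => ?_)) (integrableOn_weight h0 h1)]
  · have : Ioi (0 : ℝ) ⊆ Function.support (fun t : ℝ => t ^ (γ - 1) * (1 + t)⁻¹) := by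
      intro t ht
      have ht : 0 < t := ht
      exact ne_of_gt (by positivity)
    rw [inter_eq_right.2 this]
    simp
  · have ht : 0 < t := ht
    simp only [Pi.zero_apply]
    positivity

/-- The square root of a strictly positive element that is joined to `1` by a commuting curve. -/
theorem fpow_half_mul_self_of_curve {A A' : ℝ → 𝔸} {M K : ℝ}
    (hA : ∀ r, Positive (A r) M) (hd : ∀ r, HasDerivAt A (A' r) r) (hK : ∀ r, ‖A' r‖ ≤ K)
    (hc : ∀ r, Commute (A r) (A' r)) (hone : A 0 = 1) (r : ℝ) :
    fpow (1 / 2) (A r) * fpow (1 / 2) (A r) = A r := by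
  have hu : ∀ r, IsUnit (A r) := fun r => by simpa using (hA r).isUnit 0 le_rfl
  have hn : ∀ r, ‖Ring.inverse (A r)‖ ≤ M := fun r => by simpa using (hA r).norm_le 0 le_rfl
  have hh0 : (0 : ℝ) < 1 / 2 := by norm_num
  have hh1 : (1 / 2 : ℝ) < 1 := by norm_num
  -- The square of `A^(1/2)` and `A` itself both solve `E' = A' A⁻¹ E` with value `1` at `r = 0`;
  -- the two factors `1/2` add up to `1`.
  refine congr_fun (eq_of_hasDerivAt_mul (G := fun r => A' r * Ring.inverse (A r)) (K := K * M)
    (E := fun r => fpow (1 / 2) (A r) * fpow (1 / 2) (A r)) (F := A) (fun r => ?_) (fun r => ?_)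
    (fun r => ?_) ?_) r
  · exact (norm_mul_le _ _).trans (mul_le_mul (hK r) (hn r) (norm_nonneg _)
      ((norm_nonneg _).trans (hK r)))
  · have e := hasDerivAt_fpow hh0 hh1 hA hd hK hc r
    refine (e.mul e).congr_deriv ?_
    have hcg : Commute (A' r * Ring.inverse (A r)) (fpow (1 / 2) (A r)) :=
      commute_fpow hh0 hh1 (hA r).nonneg
        ((hc r).symm.mul_left (commute_ringInverse_right (Commute.refl _)).symm)
    rw [smul_mul_assoc, smul_mul_assoc, mul_smul_comm, ← mul_assoc, hcg.symm.eq, mul_assoc,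
      ← add_smul]
    norm_num
  · refine (hd r).congr_deriv ?_
    rw [mul_assoc, Ring.inverse_mul_cancel _ (hu r), mul_one]
  · simp only [hone, fpow_half_one, mul_one]

section Star

variable [StarRing 𝔸] [NormedStarGroup 𝔸] [StarModule ℂ 𝔸]

omit [CompleteSpace 𝔸] in
theorem star_fpow (γ : ℝ) (A : 𝔸) : star (fpow γ A) = fpow γ (star A) := by
  have h := (starL' ℝ : 𝔸 ≃L[ℝ] 𝔸).integral_comp_comm (μ := volume.restrict (Ioi 0))
    (fun t : ℝ => ((t ^ (γ - 1) : ℝ) : ℂ) • yosida A t)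
  simp only [starL'_apply] at h
  rw [fpow, fpow, star_smul, ← h]
  congr 1
  · exact Complex.conj_ofReal _
  · refine integral_congr_ae (.of_forall fun t => ?_)
    have hc : Commute A (Ring.inverse (A + (t : ℂ) • 1)) := commute_ringInverse_right
      ((Commute.refl A).add_right ((Commute.one_right A).smul_right _))
    simp only [star_smul, yosida, hc.eq, star_mul, ← Ring.inverse_star, star_add, star_one]
    simp

end Star

end Algebra

end

section

/-! ### Invertibility from a fractional power, and the Cayley curve. -/

section Algebra

variable {𝔸 : Type*} [NormedRing 𝔸] [NormedAlgebra ℂ 𝔸]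

theorem Positive.mono {A : 𝔸} {M N : ℝ} (h : Positive A M) (hMN : M ≤ N) : Positive A N :=
  ⟨h.isUnit, fun t ht => (h.norm_le t ht).trans (by gcongr)⟩

theorem Positive.isUnit_self {A : 𝔸} {M : ℝ} (h : Positive A M) : IsUnit A := by
  simpa using h.isUnit 0 le_rfl

theorem Positive.norm_inverse_le {A : 𝔸} {M : ℝ} (h : Positive A M) : ‖Ring.inverse A‖ ≤ M := by
  simpa using h.norm_le 0 le_rfl

variable [CompleteSpace 𝔸] {γ : ℝ}

theorem re_fpow (h0 : 0 < γ) (h1 : γ < 1) {A : 𝔸} {M : ℝ} (hA : Nonneg A M) (Φ : 𝔸 →L[ℂ] ℂ) :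
    (Φ (fpow γ A)).re = Real.sin (γ * Real.pi) / Real.pi *
        ∫ t in Ioi (0 : ℝ), t ^ (γ - 1) * (Φ (yosida A t)).re ∧
      IntegrableOn (fun t : ℝ => t ^ (γ - 1) * (Φ (yosida A t)).re) (Ioi 0) := by
  have hi := (Complex.reCLM.comp (Φ.restrictScalars ℝ)).integrable_comp (hA.integrableOn h0 h1)
  have e := (Complex.reCLM.comp (Φ.restrictScalars ℝ)).integral_comp_comm
    (hA.integrableOn h0 h1)
  simp only [ContinuousLinearMap.comp_apply, ContinuousLinearMap.coe_restrictScalars', map_smul,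
    Complex.reCLM_apply, smul_eq_mul, Complex.re_ofReal_mul] at hi e
  exact ⟨by rw [fpow, map_smul, smul_eq_mul, Complex.re_ofReal_mul, e], hi⟩

theorem re_fpow_nonneg (h0 : 0 < γ) (h1 : γ < 1) {A : 𝔸} {M : ℝ} (hA : Nonneg A M)
    (Φ : 𝔸 →L[ℂ] ℂ) (h : ∀ t, 0 < t → 0 ≤ (Φ (yosida A t)).re) : 0 ≤ (Φ (fpow γ A)).re := by
  rw [(re_fpow h0 h1 hA Φ).1]
  refine mul_nonneg (sin_mul_pi_div_pi_pos h0 h1).le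
    (setIntegral_nonneg measurableSet_Ioi fun t ht => ?_)
  have ht : 0 < t := ht
  exact mul_nonneg (by positivity) (h t ht)

/-- If a fractional power of `A` is invertible, then so is `A`. -/
theorem isUnit_of_isUnit_fpow (h0 : 0 < γ) (h1 : γ < 1) {A : 𝔸} {M : ℝ} (hA : Nonneg A M)
    (h : IsUnit (fpow γ A)) : IsUnit A := by
  -- Cutting the integral at `δ n` makes the resolvent itself integrable, so the truncation is a
  -- multiple of `A` from both sides. Truncations converge in norm to `A^γ` and units form an open
  -- set, so one of them is invertible, and with it the factor `A`.
  set δ : ℕ → ℝ := fun n => 1 / ((n : ℝ) + 1)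
  have hδ : ∀ n, 0 < δ n := fun n => Nat.one_div_pos_of_nat
  have hU : ⋃ n, Ioi (δ n) = Ioi 0 := by
    refine Subset.antisymm (iUnion_subset fun n => Ioi_subset_Ioi (hδ n).le) fun t ht => ?_
    obtain ⟨n, hn⟩ := exists_nat_one_div_lt (show (0 : ℝ) < t from ht)
    exact mem_iUnion.2 ⟨n, hn⟩
  have hlim := (tendsto_setIntegral_of_monotone (s := fun n => Ioi (δ n))
    (fun n => measurableSet_Ioi) (fun m n hmn => Ioi_subset_Ioi
      (Nat.one_div_le_one_div hmn)) (by rw [hU]; exact hA.integrableOn h0 h1)).const_smul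
      ((Real.sin (γ * Real.pi) / Real.pi : ℝ) : ℂ)
  rw [hU] at hlim
  obtain ⟨n, u, hn⟩ := (hlim.eventually (Units.isOpen.mem_nhds h)).exists
  have hcR : ContinuousOn (fun t : ℝ => Ring.inverse (A + (t : ℂ) • 1)) (Ioi 0) := fun t ht =>
    (hasDerivAt_resolvent (hA.isUnit t ht)).continuousAt.continuousWithinAt
  have hi : IntegrableOn (fun t : ℝ => ((t ^ (γ - 1) : ℝ) : ℂ) • Ring.inverse (A + (t : ℂ) • 1))
      (Ioi (δ n)) := by
    refine Integrable.mono' (((integrableOn_weight h0 h1).mono_set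
      (Ioi_subset_Ioi (hδ n).le)).const_mul (M * (1 + (δ n)⁻¹)))
      ((aestronglyMeasurable_kernel _ hcR).mono_set (Ioi_subset_Ioi (hδ n).le))
      ((ae_restrict_iff' measurableSet_Ioi).2 (.of_forall fun t ht => ?_))
    have ht0 : 0 < t := (hδ n).trans ht
    have hM : 0 ≤ M := by simpa using (norm_nonneg _).trans (hA.norm_le 1 one_pos)
    refine norm_kernel_le _ ht0 ((hA.norm_le t ht0).trans ?_)
    rw [← div_eq_mul_inv, div_le_div_iff₀ ht0 (by positivity), mul_assoc]
    have : 1 ≤ t * (δ n)⁻¹ := by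
      rw [← div_eq_mul_inv, le_div_iff₀ (hδ n), one_mul]; exact le_of_lt ht
    exact mul_le_mul_of_nonneg_left (by linarith) hM
  have e := (ContinuousLinearMap.mul ℂ 𝔸 A).integral_comp_comm hi
  have e' := ((ContinuousLinearMap.mul ℂ 𝔸).flip A).integral_comp_comm hi
  have hc : ∀ t : ℝ, Commute A (Ring.inverse (A + (t : ℂ) • 1)) := fun t =>
    commute_ringInverse_right ((Commute.refl A).add_right ((Commute.one_right A).smul_right _))
  simp only [ContinuousLinearMap.mul_apply', ContinuousLinearMap.flip_apply, mul_smul_comm,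
    smul_mul_assoc, ← (hc _).eq] at e e'
  have hl : A * (((Real.sin (γ * Real.pi) / Real.pi : ℝ) : ℂ) • ∫ t in Ioi (δ n),
      ((t ^ (γ - 1) : ℝ) : ℂ) • Ring.inverse (A + (t : ℂ) • 1)) = u := by
    rw [hn, mul_smul_comm, ← e]; rfl
  have hr : (((Real.sin (γ * Real.pi) / Real.pi : ℝ) : ℂ) • ∫ t in Ioi (δ n),
      ((t ^ (γ - 1) : ℝ) : ℂ) • Ring.inverse (A + (t : ℂ) • 1)) * A = u := by
    rw [hn, smul_mul_assoc, ← e']; rfl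
  exact ((Commute.isUnit_mul_iff (hl.trans hr.symm)).1 (hl ▸ u.isUnit)).1

/-- The rotated Cayley curve joining `1` to `-i (1 + Z) (1 - Z)⁻¹`. -/
def cayleyCurve (Z : 𝔸) (r : ℝ) : 𝔸 :=
  Complex.exp (-(Complex.I * (Real.pi / 2) * (Real.sin r : ℝ))) •
    ((1 + (Real.sin r : ℂ) • Z) * Ring.inverse (1 - (Real.sin r : ℂ) • Z))

/-- With `a = 1 + sin r Z`, `b = 1 - sin r Z` and `D` the Cayley curve, `D^γ b^γ` and the
correspondingly rotated `a^γ` satisfy the same linear differential equation and agree at `r = 0`.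
The parameter `sin r` gives curves on all of `ℝ` with uniform bounds, as global uniqueness requires;
the endpoint is `r = π/2`. -/
theorem fpow_cayley_mul (h0 : 0 < γ) (h1 : γ < 1) {Z : 𝔸} {M : ℝ}
    (ha : ∀ r : ℝ, Positive (1 + (Real.sin r : ℂ) • Z) M)
    (hb : ∀ r : ℝ, Positive (1 - (Real.sin r : ℂ) • Z) M)
    (hD : ∀ r : ℝ, Positive (cayleyCurve Z r) M) {κ : ℝ} (hκ : fpow γ (1 : 𝔸) = (κ : ℂ) • 1) :
    fpow γ ((-Complex.I) • ((1 + Z) * Ring.inverse (1 - Z))) * fpow γ (1 - Z) =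
      (κ : ℂ) • Complex.exp (-(Complex.I * (γ * (Real.pi / 2)))) • fpow γ (1 + Z) := by
  obtain ⟨a, ha_def⟩ : ∃ a : ℝ → 𝔸, ∀ r, a r = 1 + (Real.sin r : ℂ) • Z := ⟨_, fun _ => rfl⟩
  obtain ⟨b, hb_def⟩ : ∃ b : ℝ → 𝔸, ∀ r, b r = 1 - (Real.sin r : ℂ) • Z := ⟨_, fun _ => rfl⟩
  simp only [← ha_def, ← hb_def] at ha hb
  have hua : ∀ r, IsUnit (a r) := fun r => (ha r).isUnit_self
  have hub : ∀ r, IsUnit (b r) := fun r => (hb r).isUnit_self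
  have hna : ∀ r, ‖Ring.inverse (a r)‖ ≤ M := fun r => (ha r).norm_inverse_le
  have hnb : ∀ r, ‖Ring.inverse (b r)‖ ≤ M := fun r => (hb r).norm_inverse_le
  have hM := (ha 0).bound_nonneg
  have hZa : ∀ r, Commute Z (a r) := fun r => by
    rw [ha_def]
    exact (Commute.one_right Z).add_right ((Commute.refl Z).smul_right _)
  have hZb : ∀ r, Commute Z (b r) := fun r => by
    rw [hb_def]
    exact (Commute.one_right Z).sub_right ((Commute.refl Z).smul_right _)
  have hab : ∀ r, Commute (a r) (b r) := fun r => by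
    rw [ha_def]
    exact (Commute.one_left _).add_left ((hZb r).smul_left _)
  have hZbi := fun r => commute_ringInverse_right (hZb r)
  have habi := fun r => commute_ringInverse_right (hab r)
  have haib := fun r => (commute_ringInverse_right (hab r).symm).symm
  have haibi := fun r => commute_ringInverse_right (haib r)
  have hsin : ∀ r : ℝ, HasDerivAt (fun r : ℝ => (Real.sin r : ℂ)) (Real.cos r : ℂ) r :=
    fun r => (Real.hasDerivAt_sin r).ofReal_comp
  have hcos : ∀ r : ℝ, ‖(Real.cos r : ℂ)‖ ≤ 1 := fun r => by
    rw [Complex.norm_real]; exact Real.abs_cos_le_one r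
  have hda : ∀ r, HasDerivAt a ((Real.cos r : ℂ) • Z) r := fun r => by
    rw [funext ha_def]
    exact ((hsin r).smul_const Z).const_add 1
  have hdb : ∀ r, HasDerivAt b (-((Real.cos r : ℂ) • Z)) r := fun r => by
    rw [funext hb_def]
    exact ((hsin r).smul_const Z).const_sub 1
  have hexp : ∀ (c : ℂ) (r : ℝ), HasDerivAt (fun r : ℝ => Complex.exp (-(c * (Real.sin r : ℝ))))
      (Complex.exp (-(c * (Real.sin r : ℝ))) * -(c * Real.cos r)) r := fun c r =>
    (((hsin r).const_mul c).neg).cexp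
  set c₀ : ℂ := Complex.I * (Real.pi / 2) with hc₀
  -- `G` is the logarithmic derivative of the Cayley curve: the phase, the numerator and the
  -- denominator contribute one term each.
  obtain ⟨G, hGr⟩ : ∃ G : ℝ → 𝔸, ∀ r, G r = (Real.cos r : ℂ) • ((-c₀) • (1 : 𝔸) +
    Z * Ring.inverse (a r) + Z * Ring.inverse (b r)) := ⟨_, fun _ => rfl⟩
  have hDr : ∀ r, cayleyCurve Z r = Complex.exp (-(c₀ * (Real.sin r : ℝ))) •
    (a r * Ring.inverse (b r)) := fun r => by rw [ha_def, hb_def, cayleyCurve]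
  have hGD : ∀ r, Commute (cayleyCurve Z r) (G r) := fun r => by
    have h1 : Commute (a r * Ring.inverse (b r)) (Z * Ring.inverse (a r)) :=
      ((hZa r).symm.mul_left (hZbi r).symm).mul_right
        ((commute_ringInverse_right (Commute.refl _)).mul_left (haibi r).symm)
    have h2 : Commute (a r * Ring.inverse (b r)) (Z * Ring.inverse (b r)) :=
      ((hZa r).symm.mul_left (hZbi r).symm).mul_right
        ((habi r).mul_left (Commute.refl _))
    rw [hDr, hGr]
    exact ((((Commute.one_right _).smul_right _).add_right h1).add_right h2).smul_right _
      |>.smul_left _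
  have hdD : ∀ r, HasDerivAt (cayleyCurve Z) (G r * cayleyCurve Z r) r := fun r => by
    have e := (hexp c₀ r).smul ((hda r).mul (hasDerivAt_ringInverse (hdb r) (hub r)))
    rw [← show (fun r => Complex.exp (-(c₀ * (Real.sin r : ℝ))) • (a r * Ring.inverse (b r))) =
      cayleyCurve Z from funext fun r => (hDr r).symm]
    refine e.congr_deriv ?_
    have e1 : Z * Ring.inverse (a r) * (a r * Ring.inverse (b r)) = Z * Ring.inverse (b r) := by
      rw [mul_assoc, Ring.inverse_mul_cancel_left _ _ (hua r)]
    have e2 : Z * Ring.inverse (b r) * (a r * Ring.inverse (b r)) =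
        a r * (Ring.inverse (b r) * Z * Ring.inverse (b r)) := by
      rw [(hZbi r).eq, mul_assoc, ← mul_assoc Z, (hZa r).eq, mul_assoc (a r), ← mul_assoc,
        ← (habi r).eq]
      simp only [mul_assoc]
    simp only [hGr, Pi.mul_apply, mul_neg, neg_mul, smul_mul_assoc, mul_smul_comm, neg_neg, add_mul,
      one_mul, e1, e2]
    module
  have hGinv : ∀ r, G r * cayleyCurve Z r * Ring.inverse (cayleyCurve Z r) = G r := fun r => by
    rw [mul_assoc, Ring.mul_inverse_cancel _ (by simpa using (hD r).isUnit 0 le_rfl), mul_one]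
  have hGK : ∀ r, ‖G r‖ ≤ ‖c₀‖ * ‖(1 : 𝔸)‖ + ‖Z‖ * M + ‖Z‖ * M := fun r => by
    rw [hGr, norm_smul]
    refine (mul_le_of_le_one_left (norm_nonneg _) (hcos r)).trans ?_
    refine (norm_add₃_le).trans (add_le_add (add_le_add ?_ ?_) ?_)
    · rw [norm_smul, norm_neg]
    · exact (norm_mul_le _ _).trans (mul_le_mul_of_nonneg_left (hna r) (norm_nonneg _))
    · exact (norm_mul_le _ _).trans (mul_le_mul_of_nonneg_left (hnb r) (norm_nonneg _))
  have hCK : ∀ r, ‖cayleyCurve Z r‖ ≤ (‖(1 : 𝔸)‖ + ‖Z‖) * M := fun r => by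
    rw [hDr, norm_smul, Complex.norm_exp]
    have h1 : ‖a r‖ ≤ ‖(1 : 𝔸)‖ + ‖Z‖ := (congr_arg norm (ha_def r)).trans_le <|
      (norm_add_le _ _).trans (add_le_add_right (by
      rw [norm_smul, Complex.norm_real]
      exact mul_le_of_le_one_left (norm_nonneg _) (Real.abs_sin_le_one r)) _)
    have h2 : (-(c₀ * (Real.sin r : ℝ))).re = 0 := by simp [hc₀, -Complex.ofReal_sin]
    rw [h2, Real.exp_zero, one_mul]
    exact (norm_mul_le _ _).trans (mul_le_mul h1 (hnb r) (norm_nonneg _) (by positivity))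
  have hZn : ∀ r, ‖(Real.cos r : ℂ) • Z‖ ≤ ‖Z‖ := fun r => by
    rw [norm_smul]; exact mul_le_of_le_one_left (norm_nonneg _) (hcos r)
  have eD := hasDerivAt_fpow h0 h1 hD hdD (fun r => (norm_mul_le _ _).trans
    (mul_le_mul (hGK r) (hCK r) (norm_nonneg _) (by positivity)))
    (fun r => (hGD r).mul_right (Commute.refl _))
  have ea := hasDerivAt_fpow h0 h1 ha hda hZn (fun r => (hZa r).symm.smul_right _)
  have eb := hasDerivAt_fpow h0 h1 hb hdb (fun r => (norm_neg _).trans_le (hZn r))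
    (fun r => ((hZb r).symm.smul_right _).neg_right)
  -- The term `Z b⁻¹` in the logarithmic derivative of `D^γ` is cancelled by that of `b^γ`; what
  -- remains is the phase and the term `Z a⁻¹` of `a^γ`.
  have key := eq_of_hasDerivAt_mul
    (G := fun r => (γ : ℂ) • (Real.cos r : ℂ) • ((-c₀) • (1 : 𝔸) + Z * Ring.inverse (a r)))
    (K := |γ| * (‖c₀‖ * ‖(1 : 𝔸)‖ + ‖Z‖ * M))
    (E := fun r => fpow γ (cayleyCurve Z r) * fpow γ (b r))
    (F := fun r => (κ : ℂ) • (Complex.exp (-(γ * c₀ * (Real.sin r : ℝ))) • fpow γ (a r)))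
    (fun r => ?_) (fun r => ?_) (fun r => ?_) ?_
  · have := congr_fun key (Real.pi / 2)
    simp only [Real.sin_pi_div_two, Complex.ofReal_one, mul_one, one_smul, ha_def, hb_def,
      hDr] at this
    rw [show -c₀ = -(Real.pi : ℂ) / 2 * Complex.I by rw [hc₀]; ring,
      Complex.exp_neg_pi_div_two_mul_I]
      at this
    rw [this, hc₀]
    congr 3
    ring
  · rw [norm_smul, norm_smul, Complex.norm_real, Real.norm_eq_abs]
    refine mul_le_mul_of_nonneg_left ?_ (abs_nonneg _)
    refine (mul_le_of_le_one_left (norm_nonneg _) (hcos r)).trans ?_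
    refine (norm_add_le _ _).trans (add_le_add ?_ ?_)
    · rw [norm_smul, norm_neg]
    · exact (norm_mul_le _ _).trans (mul_le_mul_of_nonneg_left (hna r) (norm_nonneg _))
  · refine ((eD r).mul (eb r)).congr_deriv ?_
    have hcZ : Commute (Z * Ring.inverse (b r)) (fpow γ (cayleyCurve Z r)) := by
      refine commute_fpow h0 h1 (hD r).nonneg (hDr r ▸ Commute.smul_right ?_ _)
      exact ((hZa r).mul_left (habi r).symm).mul_right ((hZbi r).mul_left (Commute.refl _))
    rw [hGinv, hGr]
    simp only [neg_mul, smul_mul_assoc, mul_neg, mul_smul_comm, smul_neg, add_mul, one_mul]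
    rw [← mul_assoc (fpow γ (cayleyCurve Z r)), ← hcZ.eq]
    simp only [mul_assoc]
    module
  · refine (((hexp (γ * c₀) r).smul (ea r)).const_smul (κ : ℂ)).congr_deriv ?_
    simp only [smul_mul_assoc, mul_smul_comm, add_mul, one_mul]
    module
  · simp only [Real.sin_zero, Complex.ofReal_zero, mul_zero, neg_zero, Complex.exp_zero, hDr,
      ha_def, hb_def, zero_smul, add_zero, sub_zero, Ring.inverse_one, mul_one, one_smul, hκ,
      smul_mul_assoc, one_mul]

end Algebra

/-! ### Bounded accretive operators and their fractional powers. -/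

variable {H : Type*} [NormedAddCommGroup H] [InnerProductSpace ℂ H]

/-- Bounded accretive operators. -/
def Accretive (A : H →L[ℂ] H) : Prop := ∀ u, 0 ≤ (⟪u, A u⟫_ℂ).re

theorem inner_self_ofReal (u : H) : ⟪u, u⟫_ℂ = ((‖u‖ ^ 2 : ℝ) : ℂ) := by
  rw [inner_self_eq_norm_sq_to_K]; push_cast; rfl

variable [CompleteSpace H] {γ : ℝ}

/-- The Lax–Milgram argument; the norm bound is Cauchy–Schwarz applied to `⟪v, A v⟫` with `v = A⁻¹
x`. -/
theorem isUnit_and_norm_inverse_le {A : H →L[ℂ] H} {c : ℝ} (hc : 0 < c)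
    (h : ∀ u, c * ‖u‖ ^ 2 ≤ ‖⟪u, A u⟫_ℂ‖) : IsUnit A ∧ ‖Ring.inverse A‖ ≤ c⁻¹ := by
  have hu : IsUnit A := ContinuousLinearMap.isUnit_of_forall_le_norm_inner_map A
    (c := ⟨c, hc.le⟩) hc fun u => by
      rw [norm_inner_symm, mul_comm]; exact h u
  refine ⟨hu, ContinuousLinearMap.opNorm_le_bound _ (by positivity) fun x => ?_⟩
  have hx : A (Ring.inverse A x) = x := by
    rw [← mul_apply_eq_comp, Ring.mul_inverse_cancel _ hu,
      one_apply_eq_self]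
  have h2 := (h (Ring.inverse A x)).trans (norm_inner_le_norm _ _)
  rw [hx] at h2
  rw [inv_mul_eq_div, le_div_iff₀ hc]
  rcases (norm_nonneg (Ring.inverse A x)).eq_or_lt with h3 | h3
  · rw [← h3]; simp
  · nlinarith

/-- The constant adds the bound `c⁻¹` for the resolvent to the bound `1 + ‖A‖ c⁻¹` for `t (A + t)⁻¹
= 1 - A (A + t)⁻¹`. -/
theorem positive_of_le_norm_inner {A : H →L[ℂ] H} {c : ℝ} (hc : 0 < c)
    (h : ∀ t : ℝ, 0 ≤ t → ∀ u, c * ‖u‖ ^ 2 ≤ ‖⟪u, (A + (t : ℂ) • 1) u⟫_ℂ‖) :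
    Positive A (c⁻¹ + 1 + ‖A‖ * c⁻¹) := by
  have hu := fun t ht => isUnit_and_norm_inverse_le hc (h t ht)
  refine ⟨fun t ht => (hu t ht).1, fun t ht => ?_⟩
  obtain ⟨h1, h2⟩ := hu t ht
  have e := yosida_eq h1
  have h3 : t * ‖Ring.inverse (A + (t : ℂ) • 1)‖ ≤ 1 + ‖A‖ * c⁻¹ := by
    have e3 : t * ‖Ring.inverse (A + (t : ℂ) • 1)‖ =
        ‖(t : ℂ) • Ring.inverse (A + (t : ℂ) • 1)‖ := by
      rw [norm_smul, Complex.norm_real, Real.norm_of_nonneg ht]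
    rw [e3, show (t : ℂ) • Ring.inverse (A + (t : ℂ) • 1) = 1 - yosida A t by rw [e]; abel]
    refine (norm_sub_le _ _).trans (add_le_add ContinuousLinearMap.norm_id_le
      ((norm_mul_le _ _).trans (by gcongr)))
  rw [le_div_iff₀ (by positivity)]
  linarith

omit [CompleteSpace H] in
theorem re_inner_add_smul_one (A : H →L[ℂ] H) (t : ℝ) (u : H) :
    (⟪u, (A + (t : ℂ) • 1) u⟫_ℂ).re = (⟪u, A u⟫_ℂ).re + t * ‖u‖ ^ 2 := by
  simp only [add_apply, smul_apply,
    one_apply_eq_self, inner_add_right, inner_smul_right, inner_self_eq_norm_sq_to_K,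
    Complex.add_re, Complex.re_ofReal_mul, Complex.coe_algebraMap]
  norm_cast

theorem positive_of_le_re_inner {A : H →L[ℂ] H} {c : ℝ} (hc : 0 < c)
    (h : ∀ u, c * ‖u‖ ^ 2 ≤ (⟪u, A u⟫_ℂ).re) : Positive A (c⁻¹ + 1 + ‖A‖ * c⁻¹) :=
  positive_of_le_norm_inner hc fun t ht u => by
    refine le_trans ?_ (Complex.re_le_norm _)
    rw [re_inner_add_smul_one]
    exact (h u).trans (le_add_of_nonneg_right (by positivity))

theorem Accretive.nonneg {A : H →L[ℂ] H} (hA : Accretive A) : Nonneg A 1 := by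
  have h : ∀ t : ℝ, 0 < t → ∀ u, t * ‖u‖ ^ 2 ≤ ‖⟪u, (A + (t : ℂ) • 1) u⟫_ℂ‖ := fun t ht u => by
    refine le_trans ?_ (Complex.re_le_norm _)
    rw [re_inner_add_smul_one]
    exact le_add_of_nonneg_left (hA u)
  exact ⟨fun t ht => (isUnit_and_norm_inverse_le ht (h t ht)).1, fun t ht => by
    rw [one_div]; exact (isUnit_and_norm_inverse_le ht (h t ht)).2⟩

/-- The functional `X ↦ ⟪u, X v⟫`. -/
def innerApply (u v : H) : (H →L[ℂ] H) →L[ℂ] ℂ :=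
  (innerSL ℂ u).comp (ContinuousLinearMap.apply ℂ H v)

omit [CompleteSpace H] in
@[simp]
theorem innerApply_apply (u v : H) (X : H →L[ℂ] H) : innerApply u v X = ⟪u, X v⟫_ℂ := rfl

/-- Every `u` has the form `(A + t) v`, and then `A (A + t)⁻¹ u = A v`. -/
theorem exists_yosida_apply_eq {A : H →L[ℂ] H} {t : ℝ} (h : IsUnit (A + (t : ℂ) • 1)) (u : H) :
    ∃ v, u = A v + (t : ℂ) • v ∧ yosida A t u = A v := by
  refine ⟨Ring.inverse (A + (t : ℂ) • 1) u, ?_, rfl⟩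
  have : ((A + (t : ℂ) • 1) * Ring.inverse (A + (t : ℂ) • 1)) u = u := by
    rw [Ring.mul_inverse_cancel _ h, one_apply_eq_self]
  exact this.symm

/-- With `u = A v + t v` the right side is `‖A v‖² + t Re ⟪v, A v⟫`. -/
theorem Accretive.norm_yosida_sq_le {A : H →L[ℂ] H} (hA : Accretive A) {t : ℝ} (ht : 0 < t)
    (u : H) : ‖yosida A t u‖ ^ 2 ≤ (⟪u, yosida A t u⟫_ℂ).re := by
  obtain ⟨v, rfl, h⟩ := exists_yosida_apply_eq (hA.nonneg.isUnit t ht) u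
  rw [h, inner_add_left, inner_smul_left, Complex.conj_ofReal, Complex.add_re,
    Complex.re_ofReal_mul, inner_self_eq_norm_sq_to_K]
  norm_cast
  exact le_add_of_nonneg_right (mul_nonneg ht.le (hA v))

theorem Accretive.fpow (h0 : 0 < γ) (h1 : γ < 1) {A : H →L[ℂ] H} (hA : Accretive A) :
    Accretive (fpow γ A) := fun u =>
  re_fpow_nonneg h0 h1 hA.nonneg (innerApply u u) fun _ ht =>
    (sq_nonneg _).trans (hA.norm_yosida_sq_le ht u)

/-- Only `t ∈ (0, 1]` is kept in the integral. There `t^(γ-1) ≥ 1`, and `u = A v + t v` gives `‖A u‖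
≤ (‖A‖ + 1) ‖A v‖`. This lower bound carries injectivity and invertibility from `A` to `A^γ`. -/
theorem Accretive.exists_le_re_inner_fpow (h0 : 0 < γ) (h1 : γ < 1) {A : H →L[ℂ] H}
    (hA : Accretive A) :
    ∃ k : ℝ, 0 < k ∧ ∀ u, k * ‖A u‖ ^ 2 ≤ (⟪u, FractionalPower.fpow γ A u⟫_ℂ).re := by
  have hs := sin_mul_pi_div_pi_pos h0 h1
  refine ⟨Real.sin (γ * Real.pi) / Real.pi * ((‖A‖ + 1) ^ 2)⁻¹, by positivity, fun u => ?_⟩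
  obtain ⟨e, hi⟩ := re_fpow h0 h1 hA.nonneg (innerApply u u)
  have hlow : ∀ t ∈ Ioc (0 : ℝ) 1, ((‖A‖ + 1) ^ 2)⁻¹ * ‖A u‖ ^ 2 ≤
      t ^ (γ - 1) * (innerApply u u (yosida A t)).re := by
    intro t ht
    have hle := hA.norm_yosida_sq_le ht.1 u
    have hn : ‖A u‖ ≤ (‖A‖ + 1) * ‖yosida A t u‖ := by
      obtain ⟨v, hv, h⟩ := exists_yosida_apply_eq (hA.nonneg.isUnit t ht.1) u
      rw [h, hv, map_add, map_smul, add_mul]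
      refine (norm_add_le _ _).trans (add_le_add (A.le_opNorm _) ?_)
      rw [norm_smul, Complex.norm_real, Real.norm_of_nonneg ht.1.le]
      gcongr
      exact ht.2
    have h2 : ((‖A‖ + 1) ^ 2)⁻¹ * ‖A u‖ ^ 2 ≤ ‖yosida A t u‖ ^ 2 := by
      rw [inv_mul_le_iff₀ (by positivity), ← mul_pow]
      gcongr
    refine h2.trans (hle.trans (le_mul_of_one_le_left ((sq_nonneg _).trans hle) ?_))
    exact Real.one_le_rpow_of_pos_of_le_one_of_nonpos ht.1 ht.2 (by linarith)
  have hint : ((‖A‖ + 1) ^ 2)⁻¹ * ‖A u‖ ^ 2 ≤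
      ∫ t in Ioi (0 : ℝ), t ^ (γ - 1) * (innerApply u u (yosida A t)).re := by
    calc _ = ∫ t in Ioc (0 : ℝ) 1, ((‖A‖ + 1) ^ 2)⁻¹ * ‖A u‖ ^ 2 := by simp
      _ ≤ ∫ t in Ioc (0 : ℝ) 1, t ^ (γ - 1) * (innerApply u u (yosida A t)).re :=
        setIntegral_mono_on (integrableOn_const (by simp)) (hi.mono_set Ioc_subset_Ioi_self)
          measurableSet_Ioc hlow
      _ ≤ _ := setIntegral_mono_set hi ((ae_restrict_iff' measurableSet_Ioi).2
        (.of_forall fun t ht => mul_nonneg (Real.rpow_nonneg (le_of_lt ht) _)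
          ((sq_nonneg _).trans (hA.norm_yosida_sq_le ht u))))
        Ioc_subset_Ioi_self.eventuallyLE
  rw [← innerApply_apply, e, mul_assoc]
  exact mul_le_mul_of_nonneg_left hint hs.le

/-- The curve is the segment from `1` to `A`, parametrized by `sin² r` so that it is defined and
bounded for all real `r`. It keeps the lower bound `c` because both ends have it, the end `1` by `c
≤ 1`. -/
theorem fpow_half_mul_self_of_le_re_inner {A : H →L[ℂ] H} {c : ℝ} (hc : 0 < c) (hc1 : c ≤ 1)
    (h : ∀ u, c * ‖u‖ ^ 2 ≤ (⟪u, A u⟫_ℂ).re) :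
    FractionalPower.fpow (1 / 2) A * FractionalPower.fpow (1 / 2) A = A := by
  set F : ℝ → H →L[ℂ] H := fun r => 1 + ((Real.sin r ^ 2 : ℝ) : ℂ) • (A - 1) with hF
  have hs : ∀ r, Real.sin r ^ 2 ≤ 1 := Real.sin_sq_le_one
  have hn : ∀ r, ‖F r‖ ≤ 1 + ‖A - 1‖ := fun r => by
    refine (norm_add_le _ _).trans (add_le_add ContinuousLinearMap.norm_id_le ?_)
    rw [norm_smul, Complex.norm_real, Real.norm_of_nonneg (sq_nonneg _)]
    exact mul_le_of_le_one_left (norm_nonneg _) (hs r)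
  have hre : ∀ r u, c * ‖u‖ ^ 2 ≤ (⟪u, F r u⟫_ℂ).re := fun r u => by
    have e : (⟪u, F r u⟫_ℂ).re = ‖u‖ ^ 2 + Real.sin r ^ 2 * ((⟪u, A u⟫_ℂ).re - ‖u‖ ^ 2) := by
      simp only [hF, add_apply, smul_apply, one_apply_eq_self, sub_apply, inner_add_right,
        inner_smul_right, inner_sub_right, inner_self_eq_norm_sq_to_K, Complex.add_re,
        Complex.re_ofReal_mul, Complex.sub_re, Complex.coe_algebraMap]
      norm_cast
    rw [e]
    nlinarith [h u, hs r, sq_nonneg (Real.sin r), sq_nonneg ‖u‖,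
      mul_nonneg (sq_nonneg (Real.sin r)) (sub_nonneg.2 (h u)),
      mul_nonneg (sub_nonneg.2 (hs r)) (mul_nonneg (sub_nonneg.2 hc1) (sq_nonneg ‖u‖))]
  have key := fpow_half_mul_self_of_curve (A := F)
    (A' := fun r => ((2 * Real.sin r * Real.cos r : ℝ) : ℂ) • (A - 1))
    (M := c⁻¹ + 1 + (1 + ‖A - 1‖) * c⁻¹) (K := 2 * ‖A - 1‖)
    (fun r => (positive_of_le_re_inner hc (hre r)).mono (by have := hn r; gcongr))
    (fun r => ?_) (fun r => ?_) (fun r => ?_) (by simp [hF]) (Real.pi / 2)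
  · simpa [hF] using key
  · have e := ((Real.hasDerivAt_sin r).pow 2).ofReal_comp
    refine ((e.smul_const (A - 1)).const_add 1).congr_deriv ?_
    norm_num
  · rw [norm_smul, Complex.norm_real, Real.norm_eq_abs, abs_mul, abs_mul, abs_two]
    refine mul_le_mul_of_nonneg_right ?_ (norm_nonneg _)
    nlinarith [Real.abs_sin_le_one r, Real.abs_cos_le_one r, abs_nonneg (Real.sin r),
      abs_nonneg (Real.cos r)]
  · exact ((Commute.one_left _).add_left ((Commute.refl _).smul_left _)).smul_right _

omit [CompleteSpace H] in
theorem Accretive.add_smul_one {A : H →L[ℂ] H} (hA : Accretive A) {t : ℝ} (ht : 0 ≤ t) :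
    Accretive (A + (t : ℂ) • 1) := fun u => by
  rw [re_inner_add_smul_one]
  exact add_nonneg (hA u) (by positivity)

/-- Limit of the strictly accretive case for `A + δ`, with `δ` decreasing to `0`. -/
theorem Accretive.fpow_half_mul_self {A : H →L[ℂ] H} (hA : Accretive A) :
    FractionalPower.fpow (1 / 2) A * FractionalPower.fpow (1 / 2) A = A := by
  set δ : ℕ → ℝ := fun n => 1 / ((n : ℝ) + 1)
  have hδ : ∀ n, 0 < δ n := fun n => Nat.one_div_pos_of_nat
  have hδ1 : ∀ n, δ n ≤ 1 := fun n => by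
    simpa [δ] using Nat.one_div_le_one_div (α := ℝ) (Nat.zero_le n)
  have hlim : Tendsto (fun n => A + (δ n : ℂ) • 1) atTop (𝓝 A) := by
    have h1 : Tendsto (fun n => (δ n : ℂ)) atTop (𝓝 0) :=
      (Complex.continuous_ofReal.tendsto' 0 0 rfl).comp tendsto_one_div_add_atTop_nhds_zero_nat
    simpa using (h1.smul_const (1 : H →L[ℂ] H)).const_add A
  have hlim2 := tendsto_fpow (γ := 1 / 2) (by norm_num) (by norm_num) (K := ‖A‖ + 1)
    (fun n => (hA.add_smul_one (hδ n).le).nonneg) (fun n => (norm_add_le _ _).trans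
      (add_le_add_right (by
        rw [norm_smul, Complex.norm_real, Real.norm_of_nonneg (hδ n).le]
        exact mul_le_one₀ (hδ1 n) (norm_nonneg _) ContinuousLinearMap.norm_id_le) _)) hA.nonneg hlim
  refine tendsto_nhds_unique (hlim2.mul hlim2) (hlim.congr fun n => ?_)
  refine (fpow_half_mul_self_of_le_re_inner (hδ n) (hδ1 n) fun u => ?_).symm
  rw [re_inner_add_smul_one]
  exact le_add_of_nonneg_left (hA u)


/-! ### The half-plane inequality for powers of `1 + Z` and `1 - Z`. -/

section Contraction

omit [CompleteSpace H] in
theorem le_re_inner_one_add {Z : H →L[ℂ] H} {ρ : ℝ} (hZ : ‖Z‖ ≤ ρ) (u : H) :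
    (1 - ρ) * ‖u‖ ^ 2 ≤ (⟪u, (1 + Z) u⟫_ℂ).re := by
  have h1 := abs_le.1 ((Complex.abs_re_le_norm _).trans (norm_inner_le_norm u (Z u)))
  have h2 := Z.le_of_opNorm_le hZ u
  rw [add_apply, one_apply_eq_self, inner_add_right, Complex.add_re, inner_self_ofReal,
    Complex.ofReal_re]
  nlinarith [norm_nonneg u, h1.1]

omit [CompleteSpace H] in
theorem accretive_one_add {Z : H →L[ℂ] H} (hZ : ‖Z‖ ≤ 1) : Accretive (1 + Z) := fun u => by
  simpa using le_re_inner_one_add hZ u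

omit [CompleteSpace H] in
theorem accretive_one_sub {Z : H →L[ℂ] H} (hZ : ‖Z‖ ≤ 1) : Accretive (1 - Z) := by
  rw [sub_eq_add_neg]
  exact accretive_one_add ((norm_neg Z).trans_le hZ)

theorem isUnit_one_sub {Z : H →L[ℂ] H} {ρ : ℝ} (hZ : ‖Z‖ ≤ ρ) (hρ : ρ < 1) : IsUnit (1 - Z) :=
  isUnit_one_sub_of_norm_lt_one (hZ.trans_lt hρ)

/-- The Cayley transform of a strict contraction is strictly accretive. -/
theorem le_re_inner_cayley {Z : H →L[ℂ] H} {ρ : ℝ} (hZ : ‖Z‖ ≤ ρ) (hρ : ρ < 1) (u : H) :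
    (1 - ρ ^ 2) / 4 * ‖u‖ ^ 2 ≤ (⟪u, ((1 + Z) * Ring.inverse (1 - Z)) u⟫_ℂ).re := by
  have hu := isUnit_one_sub hZ hρ
  obtain ⟨v, hv⟩ : ∃ v, v = Ring.inverse (1 - Z) u := ⟨_, rfl⟩
  have hvu : (1 - Z) v = u := by
    rw [hv, ← mul_apply_eq_comp, Ring.mul_inverse_cancel _ hu, one_apply_eq_self]
  rw [mul_apply_eq_comp, ← hv, ← hvu]
  simp only [sub_apply, add_apply, one_apply_eq_self]
  have hρ0 : 0 ≤ ρ := (norm_nonneg Z).trans hZ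
  have h2 := Z.le_of_opNorm_le hZ v
  -- The constant `(1 - ρ²) / 4` arises from `‖v‖² - ‖Z v‖² ≥ (1 - ρ²) ‖v‖²` together with `‖u‖ ≤ 2
  -- ‖v‖`.
  have e : (⟪v - Z v, v + Z v⟫_ℂ).re = ‖v‖ ^ 2 - ‖Z v‖ ^ 2 := by
    rw [inner_sub_left, inner_add_right, inner_add_right, inner_self_ofReal,
      inner_self_ofReal, ← inner_conj_symm v (Z v)]
    simp only [Complex.sub_re, Complex.add_re, Complex.conj_re, Complex.ofReal_re]
    ring
  have h3 : ‖v - Z v‖ ≤ 2 * ‖v‖ := by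
    have := norm_sub_le v (Z v)
    nlinarith [norm_nonneg v]
  have h4 : ‖v - Z v‖ ^ 2 ≤ 4 * ‖v‖ ^ 2 := by nlinarith [norm_nonneg (v - Z v)]
  have h5 : ‖Z v‖ ^ 2 ≤ ρ ^ 2 * ‖v‖ ^ 2 := by rw [← mul_pow]; gcongr
  rw [e]
  nlinarith [mul_le_mul_of_nonneg_left h4 (by nlinarith : 0 ≤ 1 - ρ ^ 2)]

/-- For a strict contraction, `(1 + Z) ^ γ` and `(1 - Z) ^ γ` are related by a sector of
semi-angle `πγ / 2`. -/
theorem re_inner_fpow_of_norm_lt_one (h0 : 0 < γ) (h1 : γ < 1) {Z : H →L[ℂ] H} (hZ : ‖Z‖ < 1)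
    (u : H) : 0 ≤ (Complex.I * Complex.exp (-(Complex.I * (γ * (Real.pi / 2)))) *
      ⟪FractionalPower.fpow γ (1 - Z) u, FractionalPower.fpow γ (1 + Z) u⟫_ℂ).re := by
  obtain ⟨κ, hκ0, hκ⟩ := exists_fpow_one_eq (𝔸 := H →L[ℂ] H) h0 h1
  obtain ⟨ρ, hρ⟩ : ∃ ρ, ρ = ‖Z‖ := ⟨_, rfl⟩
  rw [← hρ] at hZ
  have hρ0 : 0 ≤ ρ := hρ ▸ norm_nonneg Z
  have hn : ∀ r : ℝ, ‖(Real.sin r : ℂ) • Z‖ ≤ ρ := fun r => by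
    rw [norm_smul, Complex.norm_real, hρ]
    exact mul_le_of_le_one_left (norm_nonneg _) (Real.abs_sin_le_one r)
  have hna : ∀ r : ℝ, ‖1 + (Real.sin r : ℂ) • Z‖ ≤ 1 + 1 := fun r =>
    (norm_add_le _ _).trans (add_le_add ContinuousLinearMap.norm_id_le ((hn r).trans hZ.le))
  have hnb : ∀ r : ℝ, ‖1 - (Real.sin r : ℂ) • Z‖ ≤ 1 + 1 := fun r =>
    (norm_sub_le _ _).trans (add_le_add ContinuousLinearMap.norm_id_le ((hn r).trans hZ.le))
  have hc1 : 0 < 1 - ρ := sub_pos.2 hZ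
  have hc2 : 0 < (1 - ρ ^ 2) / 4 := by nlinarith
  have hbb : ∀ (r : ℝ) (u : H), (1 - ρ) * ‖u‖ ^ 2 ≤
      (⟪u, (1 - (Real.sin r : ℂ) • Z) u⟫_ℂ).re := fun r u => by
    rw [sub_eq_add_neg 1 ((Real.sin r : ℂ) • Z)]
    exact le_re_inner_one_add ((norm_neg _).trans_le (hn r)) u
  have ha : ∀ r : ℝ, Positive (1 + (Real.sin r : ℂ) • Z)
      ((1 - ρ)⁻¹ + 1 + (1 + 1) * (1 - ρ)⁻¹) := fun r =>
    (positive_of_le_re_inner hc1 (le_re_inner_one_add (hn r))).mono (by have := hna r; gcongr)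
  have hb : ∀ r : ℝ, Positive (1 - (Real.sin r : ℂ) • Z)
      ((1 - ρ)⁻¹ + 1 + (1 + 1) * (1 - ρ)⁻¹) := fun r =>
    (positive_of_le_re_inner hc1 (hbb r)).mono (by have := hnb r; gcongr)
  have hbi : ∀ r : ℝ, ‖Ring.inverse (1 - (Real.sin r : ℂ) • Z)‖ ≤ (1 - ρ)⁻¹ := fun r =>
    (isUnit_and_norm_inverse_le hc1 fun u => (hbb r u).trans (Complex.re_le_norm _)).2
  have hexp : ∀ r : ℝ, -(Complex.I * (Real.pi / 2) * (Real.sin r : ℝ)) =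
      ((-(Real.pi / 2 * Real.sin r) : ℝ) : ℂ) * Complex.I := fun r => by push_cast; ring
  have hDn : ∀ r : ℝ, ‖cayleyCurve Z r‖ ≤ (1 + 1) * (1 - ρ)⁻¹ := fun r => by
    rw [cayleyCurve, norm_smul, hexp, Complex.norm_exp_ofReal_mul_I, one_mul]
    exact (norm_mul_le _ _).trans (mul_le_mul (hna r) (hbi r) (norm_nonneg _) (by norm_num))
  have hD : ∀ r : ℝ, Positive (cayleyCurve Z r)
      (((1 - ρ ^ 2) / 4)⁻¹ + 1 + ((1 + 1) * (1 - ρ)⁻¹) * ((1 - ρ ^ 2) / 4)⁻¹) := fun r => by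
    refine (positive_of_le_norm_inner hc2 fun t ht u => ?_).mono (by have := hDn r; gcongr)
    have hC := le_re_inner_cayley (hn r) hZ u
    -- Multiplying by `exp (iθ)` undoes the rotation of the curve. The shift `t` then contributes `t
    -- cos θ ‖u‖²` to the real part, which is nonnegative as `|θ| ≤ π/2`.
    obtain ⟨θ, hθ⟩ : ∃ θ, θ = Real.pi / 2 * Real.sin r := ⟨_, rfl⟩
    have hcos : 0 ≤ Real.cos θ := by
      have := Real.neg_one_le_sin r
      have := Real.sin_le_one r
      have := Real.pi_pos
      rw [hθ]
      exact Real.cos_nonneg_of_neg_pi_div_two_le_of_le (by nlinarith) (by nlinarith)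
    have e : Complex.exp (θ * Complex.I) * ⟪u, (cayleyCurve Z r + (t : ℂ) • 1) u⟫_ℂ =
        ⟪u, ((1 + (Real.sin r : ℂ) • Z) * Ring.inverse (1 - (Real.sin r : ℂ) • Z)) u⟫_ℂ +
          ((t * ‖u‖ ^ 2 : ℝ) : ℂ) * Complex.exp (θ * Complex.I) := by
      have h9 : Complex.exp (θ * Complex.I) * Complex.exp (((-θ : ℝ) : ℂ) * Complex.I) = 1 := by
        rw [← Complex.exp_add, Complex.ofReal_neg, neg_mul, add_neg_cancel, Complex.exp_zero]
      rw [cayleyCurve, hexp, ← hθ, add_apply, smul_apply, smul_apply, one_apply_eq_self,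
        inner_add_right,
        inner_smul_right, inner_smul_right, inner_self_ofReal, Complex.ofReal_mul t]
      linear_combination ⟪u, ((1 + (Real.sin r : ℂ) • Z) *
        Ring.inverse (1 - (Real.sin r : ℂ) • Z)) u⟫_ℂ * h9
    have e' : ‖⟪u, (cayleyCurve Z r + (t : ℂ) • 1) u⟫_ℂ‖ = ‖Complex.exp (θ * Complex.I) *
        ⟪u, (cayleyCurve Z r + (t : ℂ) • 1) u⟫_ℂ‖ := by
      rw [norm_mul, Complex.norm_exp_ofReal_mul_I, one_mul]
    rw [e', e]
    refine le_trans ?_ (Complex.re_le_norm _)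
    rw [Complex.add_re, Complex.re_ofReal_mul, Complex.exp_ofReal_mul_I_re]
    exact hC.trans (le_add_of_nonneg_right (by positivity))
  obtain ⟨N, hN1, hN2⟩ : ∃ N, (1 - ρ)⁻¹ + 1 + (1 + 1) * (1 - ρ)⁻¹ ≤ N ∧
      ((1 - ρ ^ 2) / 4)⁻¹ + 1 + ((1 + 1) * (1 - ρ)⁻¹) * ((1 - ρ ^ 2) / 4)⁻¹ ≤ N :=
    ⟨_, le_max_left _ _, le_max_right _ _⟩
  have key := fpow_cayley_mul h0 h1 (fun r => (ha r).mono hN1) (fun r => (hb r).mono hN1)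
    (fun r => (hD r).mono hN2) hκ
  have hDp := (hD (Real.pi / 2)).nonneg
  have hDe : cayleyCurve Z (Real.pi / 2) =
      (-Complex.I) • ((1 + Z) * Ring.inverse (1 - Z)) := by
    rw [cayleyCurve, Real.sin_pi_div_two, Complex.ofReal_one, one_smul, mul_one,
      show -(Complex.I * (Real.pi / 2)) = -(Real.pi : ℂ) / 2 * Complex.I by ring,
      Complex.exp_neg_pi_div_two_mul_I]
  rw [hDe] at hDp
  set w := FractionalPower.fpow γ (1 - Z) u
  -- For `D = -iC` and `w = D v + t v` one has `i ⟪w, D v⟫ = i ‖C v‖² + t ⟪v, C v⟫`, whose real part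
  -- is nonnegative. Hence `i D^γ` is accretive.
  have hpos := re_fpow_nonneg h0 h1 hDp (Complex.I • innerApply w w) fun t ht => by
    obtain ⟨v, hv, hy⟩ := exists_yosida_apply_eq (hDp.isUnit t ht) w
    have hC := le_re_inner_cayley hρ.ge hZ v
    rw [smul_apply, innerApply_apply, hy, hv, smul_apply]
    set y := ((1 + Z) * Ring.inverse (1 - Z)) v
    have e : Complex.I • ⟪-Complex.I • y + (t : ℂ) • v, -Complex.I • y⟫_ℂ =
        ((‖y‖ ^ 2 : ℝ) : ℂ) * Complex.I + (t : ℂ) * ⟪v, y⟫_ℂ := by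
      rw [inner_add_left, inner_smul_left, inner_smul_left, inner_smul_right, inner_smul_right,
        inner_self_ofReal, Complex.conj_ofReal, smul_eq_mul, map_neg, Complex.conj_I]
      linear_combination (-Complex.I * ((‖y‖ ^ 2 : ℝ) : ℂ) - (t : ℂ) * ⟪v, y⟫_ℂ) * Complex.I_sq
    rw [e, Complex.add_re, Complex.re_ofReal_mul, Complex.re_ofReal_mul, Complex.I_re, mul_zero,
      zero_add]
    exact mul_nonneg ht.le ((by positivity : (0 : ℝ) ≤ (1 - ρ ^ 2) / 4 * ‖v‖ ^ 2).trans hC)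
  have key2 := congr_arg (fun X : H →L[ℂ] H => X u) key
  simp only [mul_apply_eq_comp, smul_apply] at key2
  rw [smul_apply, innerApply_apply, key2, inner_smul_right, inner_smul_right, smul_eq_mul,
    mul_left_comm, Complex.re_ofReal_mul, ← mul_assoc] at hpos
  exact nonneg_of_mul_nonneg_right hpos hκ0

/-- Limit of the strict case along `ρ Z` with `ρ → 1`, by norm continuity of the fractional power.
-/
theorem re_inner_fpow_of_norm_le_one (h0 : 0 < γ) (h1 : γ < 1) {Z : H →L[ℂ] H} (hZ : ‖Z‖ ≤ 1)
    (u : H) : 0 ≤ (Complex.I * Complex.exp (-(Complex.I * (γ * (Real.pi / 2)))) *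
      ⟪FractionalPower.fpow γ (1 - Z) u, FractionalPower.fpow γ (1 + Z) u⟫_ℂ).re := by
  obtain ⟨ρ, hρ⟩ : ∃ ρ : ℕ → ℝ, ∀ n, ρ n = 1 - 1 / ((n : ℝ) + 1) := ⟨_, fun _ => rfl⟩
  have hδ : ∀ n : ℕ, 0 < 1 / ((n : ℝ) + 1) := fun n => Nat.one_div_pos_of_nat
  have hδ1 : ∀ n : ℕ, 1 / ((n : ℝ) + 1) ≤ 1 := fun n => by
    simpa using Nat.one_div_le_one_div (α := ℝ) (Nat.zero_le n)
  have hn : ∀ n, ‖(ρ n : ℂ) • Z‖ < 1 := fun n => by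
    rw [norm_smul, Complex.norm_real, Real.norm_of_nonneg (by rw [hρ]; linarith [hδ1 n])]
    refine (mul_le_of_le_one_right ?_ hZ).trans_lt ?_ <;> rw [hρ] <;> linarith [hδ n, hδ1 n]
  have hlim : Tendsto (fun n => (ρ n : ℂ) • Z) atTop (𝓝 Z) := by
    have h2 : Tendsto ρ atTop (𝓝 1) := by
      rw [funext hρ]
      simpa using (tendsto_one_div_add_atTop_nhds_zero_nat (𝕜 := ℝ)).const_sub 1
    have h1 : Tendsto (fun n => (ρ n : ℂ)) atTop (𝓝 1) :=
      (Complex.continuous_ofReal.tendsto' 1 1 rfl).comp h2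
    simpa using h1.smul_const Z
  have hK : ∀ {X : H →L[ℂ] H}, ‖X‖ < 1 → ‖1 + X‖ ≤ 1 + 1 := fun hX =>
    (norm_add_le _ _).trans (add_le_add ContinuousLinearMap.norm_id_le hX.le)
  have hK' : ∀ {X : H →L[ℂ] H}, ‖X‖ < 1 → ‖1 - X‖ ≤ 1 + 1 := fun hX =>
    (norm_sub_le _ _).trans (add_le_add ContinuousLinearMap.norm_id_le hX.le)
  have l1 := tendsto_fpow h0 h1 (fun n => (accretive_one_add (hn n).le).nonneg)
    (fun n => hK (hn n)) (accretive_one_add hZ).nonneg (hlim.const_add 1)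
  have l2 := tendsto_fpow h0 h1 (fun n => (accretive_one_sub (hn n).le).nonneg)
    (fun n => hK' (hn n)) (accretive_one_sub hZ).nonneg (hlim.const_sub 1)
  have ev : Continuous fun X : H →L[ℂ] H => X u := (ContinuousLinearMap.apply ℂ H u).continuous
  refine ge_of_tendsto' ((Complex.continuous_re.tendsto _).comp (Tendsto.const_mul _
    (((ev.tendsto _).comp l2).inner ((ev.tendsto _).comp l1)))) fun n => ?_
  exact re_inner_fpow_of_norm_lt_one h0 h1 (hn n) u

end Contraction

end

/-! ### Uniqueness of accretive roots, the factorization, and the transformed contraction. -/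

section

variable {H : Type*} [NormedAddCommGroup H] [InnerProductSpace ℂ H] [CompleteSpace H] {γ : ℝ}

theorem inner_star_left (A : H →L[ℂ] H) (x y : H) : ⟪star A x, y⟫_ℂ = ⟪x, A y⟫_ℂ :=
  A.adjoint_inner_left y x

theorem inner_star_right (A : H →L[ℂ] H) (x y : H) : ⟪x, star A y⟫_ℂ = ⟪A x, y⟫_ℂ :=
  A.adjoint_inner_right x y

theorem denseRange_of_star_injective {A : H →L[ℂ] H} (h : ∀ x, star A x = 0 → x = 0) :
    DenseRange A := by
  have h1 : A.rangeᗮ = ⊥ := by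
    rw [A.orthogonal_range, Submodule.eq_bot_iff]
    exact fun x hx => h x hx
  rw [← Submodule.topologicalClosure_eq_top_iff] at h1
  have h2 := congr_arg (fun p : Submodule ℂ H => (p : Set H)) h1
  simp only [Submodule.topologicalClosure_coe] at h2
  rw [DenseRange, dense_iff_closure_eq]
  exact h2

theorem Accretive.star {A : H →L[ℂ] H} (hA : Accretive A) : Accretive (star A) := fun u => by
  rw [inner_star_right, ← inner_conj_symm, Complex.conj_re]
  exact hA u

/-- Minimum principle for a nonnegative quadratic form: with `w = (A + A*) u`, moving from `u` to `u
+ s w` changes the form to first order by `s ‖w‖²`, so a small negative `s` would make it negative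
unless `w = 0`. -/
theorem Accretive.add_star_apply_eq_zero {A : H →L[ℂ] H} (hA : Accretive A) {u : H}
    (h : (⟪u, A u⟫_ℂ).re = 0) : (A + Star.star A) u = 0 := by
  obtain ⟨w, hw⟩ : ∃ w, w = (A + Star.star A) u := ⟨_, rfl⟩
  have h1 : ∀ s : ℝ, 0 ≤ s * ‖w‖ ^ 2 + s ^ 2 * (⟪w, A w⟫_ℂ).re := fun s => by
    have h2 := hA (u + (s : ℂ) • w)
    have e : (⟪w, w⟫_ℂ).re = (⟪u, A w⟫_ℂ).re + (⟪w, A u⟫_ℂ).re := by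
      nth_rw 2 [hw]
      rw [add_apply, inner_add_right, Complex.add_re, inner_star_right, ← inner_conj_symm,
        Complex.conj_re, add_comm]
      congr 1
      rw [← inner_conj_symm, Complex.conj_re]
    rw [inner_self_ofReal, Complex.ofReal_re] at e
    simp only [map_add, map_smul, inner_add_left, inner_add_right, inner_smul_left,
      inner_smul_right, Complex.conj_ofReal, Complex.add_re, Complex.re_ofReal_mul, h] at h2
    rw [e]
    linarith
  rw [← hw, ← norm_eq_zero]
  by_contra hne
  have hpos : 0 < ‖w‖ ^ 2 := by positivity
  set c := (⟪w, A w⟫_ℂ).re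
  have hc : 0 ≤ c := hA w
  -- Close to the minimizing `s`; the denominator `c + 1` stays positive also when `c = 0`.
  have h3 := h1 (-(‖w‖ ^ 2 / (c + 1)))
  have h4 : -(‖w‖ ^ 2 / (c + 1)) * ‖w‖ ^ 2 + (-(‖w‖ ^ 2 / (c + 1))) ^ 2 * c =
      -((‖w‖ ^ 2 / (c + 1)) ^ 2) := by
    field_simp
    ring
  rw [h4] at h3
  have : 0 < (‖w‖ ^ 2 / (c + 1)) ^ 2 := by positivity
  linarith

theorem Accretive.star_apply_eq_zero {A : H →L[ℂ] H} (hA : Accretive A) {u : H} (h : A u = 0) :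
    Star.star A u = 0 := by
  have := hA.add_star_apply_eq_zero (u := u) (by rw [h, inner_zero_right, Complex.zero_re])
  rwa [add_apply, h, zero_add] at this

theorem Accretive.denseRange {A : H →L[ℂ] H} (hA : Accretive A) (h : ∀ x, A x = 0 → x = 0) :
    DenseRange A :=
  denseRange_of_star_injective fun x hx => h x (by simpa using hA.star.star_apply_eq_zero hx)

/-- The accretive square root is unique. -/
theorem fpow_half_mul_self_eq {T : H →L[ℂ] H} (hT : Accretive T) (hT2 : Accretive (T * T))
    (hinj : ∀ u, (T + star T) u = 0 → u = 0) : fpow (1 / 2) (T * T) = T := by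
  have hh0 : (0 : ℝ) < 1 / 2 := by norm_num
  have hh1 : (1 / 2 : ℝ) < 1 := by norm_num
  set S := fpow (1 / 2) (T * T)
  have hc : Commute T S := commute_fpow hh0 hh1 hT2.nonneg ((Commute.refl T).mul_right
    (Commute.refl T))
  have h2 : S * S = T * T := hT2.fpow_half_mul_self
  -- The commuting roots satisfy `(T + S)(S - T) = 0`. On a vector `v` of the range of `S - T` both
  -- accretive forms therefore vanish, and the injectivity of `T + T*` gives `v = 0`.
  have h3 : (T + S) * (S - T) = 0 := by
    rw [add_mul, mul_sub, mul_sub, h2, hc.eq]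
    abel
  ext u
  rw [← sub_eq_zero, ← sub_apply]
  set v := (S - T) u
  have h4 : (T + S) v = 0 := by
    rw [← mul_apply_eq_comp, h3, zero_apply]
  have h5 := congr_arg (fun x => (⟪v, x⟫_ℂ).re) h4
  simp only [add_apply, inner_add_right, Complex.add_re, inner_zero_right, Complex.zero_re] at h5
  have h6 : 0 ≤ (⟪v, S v⟫_ℂ).re := hT2.fpow hh0 hh1 v
  exact hinj v (hT.add_star_apply_eq_zero (by linarith [hT v]))

/-- Factorization of the imaginary part of an accretive square root through its real part. -/
theorem exists_contraction_factor {S : H →L[ℂ] H} (hS2 : Accretive (S * S))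
    (hinj : ∀ u, ((1 / 2 : ℂ) • (S + star S)) u = 0 → u = 0) :
    ∃ Z : H →L[ℂ] H, ‖Z‖ ≤ 1 ∧ ((1 / 2 : ℂ) • (S + star S)) * Z = (1 / 2 : ℂ) • (S - star S) := by
  set X := (1 / 2 : ℂ) • (S + star S) with hX
  set D := (1 / 2 : ℂ) • (S - star S) with hD
  have hXs : star X = X := by
    rw [hX, star_smul, star_add, star_star, add_comm]; simp
  have hDs : star D = -D := by
    rw [hD, star_smul, star_sub, star_star, ← smul_neg, neg_sub]; simp
  have hdense : DenseRange X := denseRange_of_star_injective (by rwa [hXs])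
  -- The cross term in `‖S* u ± S u‖²` is `±2 Re ⟪u, S² u⟫`, so accretivity of `S²` orders the two
  -- norms.
  have hle : ∀ u, ‖D u‖ ≤ 1 * ‖X u‖ := fun u => by
    have h1 := hS2 u
    rw [mul_apply_eq_comp, ← inner_star_left] at h1
    have h2 := norm_add_sq (𝕜 := ℂ) (star S u) (S u)
    have h3 := norm_sub_sq (𝕜 := ℂ) (star S u) (S u)
    simp only [RCLike.re_to_complex] at h2 h3
    have h4 : ‖star S u - S u‖ ≤ ‖star S u + S u‖ := by
      refine (sq_le_sq₀ (norm_nonneg _) (norm_nonneg _)).1 ?_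
      linarith
    rw [one_mul, hD, hX, smul_apply, smul_apply, norm_smul, norm_smul, sub_apply, add_apply,
      norm_sub_rev, add_comm (S u)]
    gcongr
  set K := (D : H →ₗ[ℂ] H).extendOfNorm (X : H →ₗ[ℂ] H)
  have hK : K * X = D := by
    ext u
    exact LinearMap.extendOfNorm_eq (f := (D : H →ₗ[ℂ] H)) (e := (X : H →ₗ[ℂ] H)) hdense
      ⟨1, hle⟩ u
  -- Taking adjoints in `K X = D` puts `X` on the left, and the sign appears because `D` is
  -- skew-adjoint.
  refine ⟨-star K, ?_, ?_⟩
  · rw [norm_neg, norm_star]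
    exact LinearMap.opNorm_extendOfNorm_le hdense zero_le_one hle
  · have := congr_arg star hK
    rw [star_mul, hXs, hDs] at this
    rw [mul_neg, this, neg_neg]

/-- A contraction `Z` and an injective positive operator `X` with `Z* X = - X Z`. -/
structure KatoPair (X Z : H →L[ℂ] H) : Prop where
  star_eq : star X = X
  accretive : Accretive X
  injective : ∀ u, X u = 0 → u = 0
  norm_le : ‖Z‖ ≤ 1
  star_mul_eq : star Z * X = -(X * Z)
  injective_add : ∀ u, (1 + Z) u = 0 → u = 0
  injective_sub : ∀ u, (1 - Z) u = 0 → u = 0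

theorem exists_katoPair {S : H →L[ℂ] H} (hS : Accretive S) (hS2 : Accretive (S * S))
    (hinj : ∀ u, S u = 0 → u = 0) : ∃ X Z : H →L[ℂ] H, KatoPair X Z ∧
      X = (1 / 2 : ℂ) • (S + star S) ∧ X * Z = (1 / 2 : ℂ) • (S - star S) ∧
      S = X * (1 + Z) ∧ star S = X * (1 - Z) := by
  obtain ⟨X, hX⟩ : ∃ X, X = (1 / 2 : ℂ) • (S + star S) := ⟨_, rfl⟩
  have hXacc : Accretive X := fun u => by
    have h1 : ((1 / 2 : ℂ)) = ((1 / 2 : ℝ) : ℂ) := by norm_num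
    rw [hX, smul_apply, inner_smul_right, h1, Complex.re_ofReal_mul, add_apply, inner_add_right,
      Complex.add_re]
    exact mul_nonneg (by norm_num) (add_nonneg (hS u) (hS.star u))
  -- If `Re S` kills `u` then `S* u = -S u`, so `0 ≤ Re ⟪u, S² u⟫ = -‖S u‖²`.
  have hXinj : ∀ u, X u = 0 → u = 0 := fun u hu => by
    have h1 : (S + star S) u = 0 := by
      rw [hX, smul_apply, smul_eq_zero] at hu
      exact hu.resolve_left (by norm_num)
    have h2 : star S u = -S u := by
      rw [add_apply, add_comm] at h1
      exact eq_neg_of_add_eq_zero_left h1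
    have h3 := hS2 u
    rw [mul_apply_eq_comp, ← inner_star_left, h2, inner_neg_left, Complex.neg_re,
      inner_self_ofReal, Complex.ofReal_re] at h3
    refine hinj u (norm_eq_zero.1 ?_)
    nlinarith [norm_nonneg (S u)]
  have hXs : star X = X := by
    rw [hX, star_smul, star_add, star_star, add_comm]; simp
  obtain ⟨Z, hZ, hXZ⟩ := exists_contraction_factor hS2 (by rwa [← hX])
  rw [← hX] at hXZ
  have e1 : S = X * (1 + Z) := by
    rw [mul_add, mul_one, hXZ, hX, ← smul_add]
    module
  have e2 : star S = X * (1 - Z) := by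
    rw [mul_sub, mul_one, hXZ, hX, ← smul_sub]
    module
  refine ⟨X, Z, ⟨hXs, hXacc, hXinj, hZ, ?_, fun u hu => hinj u ?_, fun u hu => hinj u ?_⟩, hX, hXZ,
    e1, e2⟩
  · have := congr_arg star hXZ
    rw [star_mul, hXs, star_smul, star_sub, star_star] at this
    rw [this, hXZ, ← smul_neg, neg_sub]
    simp
  · rw [e1, mul_apply_eq_comp, hu, map_zero]
  · have : star S u = 0 := by rw [e2, mul_apply_eq_comp, hu, map_zero]
    simpa using hS.star.star_apply_eq_zero this

/-- The contraction built from the fractional powers of `1 + Z` and `1 - Z`. -/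
def cpow (γ : ℝ) (Z : H →L[ℂ] H) : H →L[ℂ] H :=
  (fpow γ (1 + Z) - fpow γ (1 - Z)) * Ring.inverse (fpow γ (1 + Z) + fpow γ (1 - Z))

/-! ### Sector, norm and invertibility properties of the transformed contraction. -/

section Contraction

variable {Z : H →L[ℂ] H}

theorem isUnit_fpow_of_isUnit (h0 : 0 < γ) (h1 : γ < 1) {A : H →L[ℂ] H} (hA : Accretive A)
    (hu : IsUnit A) : IsUnit (fpow γ A) := by
  obtain ⟨k, hk, h⟩ := hA.exists_le_re_inner_fpow h0 h1
  set c := ‖Ring.inverse A‖ + 1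
  have hc : 0 < c := by positivity
  refine (isUnit_and_norm_inverse_le (c := k / c ^ 2) (by positivity) fun u =>
    le_trans ?_ ((h u).trans (Complex.re_le_norm _))).1
  have h2 : ‖u‖ ≤ c * ‖A u‖ := by
    have h3 : u = Ring.inverse A (A u) := by
      rw [← mul_apply_eq_comp, Ring.inverse_mul_cancel _ hu, one_apply_eq_self]
    calc ‖u‖ = ‖Ring.inverse A (A u)‖ := by rw [← h3]
      _ ≤ ‖Ring.inverse A‖ * ‖A u‖ := ContinuousLinearMap.le_opNorm _ _
      _ ≤ _ := by gcongr; exact le_add_of_nonneg_right zero_le_one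
  rw [div_mul_eq_mul_div, div_le_iff₀ (by positivity), mul_assoc, mul_comm (_ ^ 2), ← mul_pow]
  gcongr

/-- The lower bounds by `‖(1 ± Z) u‖²` add up, by the parallelogram law, to a multiple of `‖u‖² + ‖Z
u‖²`. So the sum is coercive even if neither `1 + Z` nor `1 - Z` is invertible. -/
theorem isUnit_fpow_add_fpow (h0 : 0 < γ) (h1 : γ < 1) (hZ : ‖Z‖ ≤ 1) :
    IsUnit (fpow γ (1 + Z) + fpow γ (1 - Z)) := by
  obtain ⟨k, hk, h⟩ := (accretive_one_add hZ).exists_le_re_inner_fpow h0 h1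
  obtain ⟨l, hl, h'⟩ := (accretive_one_sub hZ).exists_le_re_inner_fpow h0 h1
  obtain ⟨m, hm, hmk, hml⟩ : ∃ m, 0 < m ∧ m ≤ k ∧ m ≤ l :=
    ⟨min k l, lt_min hk hl, min_le_left _ _, min_le_right _ _⟩
  refine (isUnit_and_norm_inverse_le (c := 2 * m) (by positivity) fun u =>
    le_trans ?_ (Complex.re_le_norm _)).1
  rw [add_apply, inner_add_right, Complex.add_re]
  have h2 := parallelogram_law_with_norm ℂ u (Z u)
  have h3 := h u
  have h4 := h' u
  simp only [add_apply, sub_apply, one_apply_eq_self] at h3 h4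
  nlinarith [sq_nonneg ‖u + Z u‖, sq_nonneg ‖u - Z u‖, sq_nonneg ‖Z u‖,
    mul_le_mul_of_nonneg_right hmk (sq_nonneg ‖u + Z u‖),
    mul_le_mul_of_nonneg_right hml (sq_nonneg ‖u - Z u‖), mul_nonneg hm.le (sq_nonneg ‖Z u‖)]

/-- Replacing `Z` by `-Z` exchanges the two powers and conjugates the inner product. The two
half-planes so obtained intersect in the sector. -/
theorem sector_inner_fpow (h0 : 0 < γ) (h1 : γ < 1) (hZ : ‖Z‖ ≤ 1) (u : H) :
    Real.cos (Real.pi * γ / 2) * |(⟪fpow γ (1 - Z) u, fpow γ (1 + Z) u⟫_ℂ).im| ≤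
      Real.sin (Real.pi * γ / 2) * (⟪fpow γ (1 - Z) u, fpow γ (1 + Z) u⟫_ℂ).re := by
  have e1 := re_inner_fpow_of_norm_le_one h0 h1 hZ u
  have e2 := re_inner_fpow_of_norm_le_one h0 h1 ((norm_neg Z).trans_le hZ) u
  rw [sub_neg_eq_add, ← sub_eq_add_neg, ← inner_conj_symm] at e2
  have h3 : Complex.I * Complex.exp (-(Complex.I * (γ * (Real.pi / 2)))) =
      (Real.sin (Real.pi * γ / 2) : ℂ) + (Real.cos (Real.pi * γ / 2) : ℂ) * Complex.I := by
    rw [show -(Complex.I * (γ * (Real.pi / 2))) = ((-(Real.pi * γ / 2) : ℝ) : ℂ) * Complex.I by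
      push_cast; ring, Complex.exp_mul_I, ← Complex.ofReal_cos, ← Complex.ofReal_sin,
      Real.cos_neg, Real.sin_neg, Complex.ofReal_neg]
    linear_combination -(Real.sin (Real.pi * γ / 2) : ℂ) * Complex.I_sq
  have h4 : ∀ (s c : ℝ) (z : ℂ), (((s : ℂ) + (c : ℂ) * Complex.I) * z).re = s * z.re - c * z.im :=
    fun s c z => by simp
  rw [h3, h4] at e1 e2
  rw [Complex.conj_re, Complex.conj_im] at e2
  rcases abs_cases (⟪fpow γ (1 - Z) u, fpow γ (1 + Z) u⟫_ℂ).im with h | h <;> rw [h.1] <;> linarith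

omit [CompleteSpace H] in
-- After squaring, the cross term is `±4 s c Im ⟪q, p⟫`, to be absorbed by `s² (‖p + q‖² - ‖p - q‖²)
-- = 4 s² Re ⟪q, p⟫`. It is applied with `p` and `q` the two fractional powers at `u`, where `p + q
-- = x` and `p - q = Z_γ x`.
theorem norm_rotate_le {p q : H} {s c : ℝ} (hsc : s ^ 2 + c ^ 2 = 1) (hs : 0 ≤ s) (hc : 0 ≤ c)
    (h : c * |(⟪q, p⟫_ℂ).im| ≤ s * (⟪q, p⟫_ℂ).re) :
    ‖(s : ℂ) • (p - q) + (Complex.I * (c : ℂ)) • (p + q)‖ ≤ ‖p + q‖ ∧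
      ‖(s : ℂ) • (p - q) - (Complex.I * (c : ℂ)) • (p + q)‖ ≤ ‖p + q‖ := by
  have hi : (⟪p - q, p + q⟫_ℂ).im = -(2 * (⟪q, p⟫_ℂ).im) := by
    rw [inner_sub_left, inner_add_right, inner_add_right, inner_self_ofReal, inner_self_ofReal,
      ← inner_conj_symm p q]
    simp only [Complex.sub_im, Complex.add_im, Complex.conj_im, Complex.ofReal_im]
    ring
  have h1 := norm_add_sq (𝕜 := ℂ) ((s : ℂ) • (p - q)) ((Complex.I * (c : ℂ)) • (p + q))
  have h2 := norm_sub_sq (𝕜 := ℂ) ((s : ℂ) • (p - q)) ((Complex.I * (c : ℂ)) • (p + q))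
  have h3 : (⟪(s : ℂ) • (p - q), (Complex.I * (c : ℂ)) • (p + q)⟫_ℂ).re =
      2 * s * c * (⟪q, p⟫_ℂ).im := by
    rw [inner_smul_left, inner_smul_right, Complex.conj_ofReal, Complex.re_ofReal_mul,
      mul_comm Complex.I, mul_assoc, Complex.re_ofReal_mul, Complex.I_mul_re, hi]
    ring
  have h4 := norm_add_sq (𝕜 := ℂ) p q
  have h5 := norm_sub_sq (𝕜 := ℂ) p q
  have h6 : (⟪p, q⟫_ℂ).re = (⟪q, p⟫_ℂ).re := by rw [← inner_conj_symm, Complex.conj_re]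
  simp only [RCLike.re_to_complex, h6] at h4 h5
  simp only [RCLike.re_to_complex, h3, norm_smul, mul_pow, norm_mul, Complex.norm_I,
    Complex.norm_real, Real.norm_eq_abs, sq_abs, one_mul] at h1 h2
  have h7 := mul_le_mul_of_nonneg_left h hs
  have h9 : c ^ 2 = 1 - s ^ 2 := by linarith
  rw [h9] at h1 h2
  have h10 : |s * (c * (⟪q, p⟫_ℂ).im)| ≤ s * (s * (⟪q, p⟫_ℂ).re) := by
    rw [abs_mul, abs_mul, abs_of_nonneg hs, abs_of_nonneg hc]
    exact h7
  have h11 := abs_le.1 h10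
  have h12 : s ^ 2 * ‖p + q‖ ^ 2 - s ^ 2 * ‖p - q‖ ^ 2 = 4 * (s * (s * (⟪q, p⟫_ℂ).re)) := by
    rw [h4, h5]; ring
  constructor <;> refine (sq_le_sq₀ (norm_nonneg _) (norm_nonneg _)).1 ?_ <;> linarith

theorem cos_pos_sin_pos (h0 : 0 < γ) (h1 : γ < 1) :
    0 < Real.cos (Real.pi * γ / 2) ∧ 0 < Real.sin (Real.pi * γ / 2) := by
  have hpi := Real.pi_pos
  exact ⟨Real.cos_pos_of_mem_Ioo ⟨by nlinarith, by nlinarith⟩,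
    Real.sin_pos_of_pos_of_lt_pi (by positivity) (by nlinarith)⟩

theorem exists_cpow_apply (h0 : 0 < γ) (h1 : γ < 1) (hZ : ‖Z‖ ≤ 1) (x : H) :
    ∃ u, x = fpow γ (1 + Z) u + fpow γ (1 - Z) u ∧
      cpow γ Z x = fpow γ (1 + Z) u - fpow γ (1 - Z) u := by
  refine ⟨Ring.inverse (fpow γ (1 + Z) + fpow γ (1 - Z)) x, ?_, rfl⟩
  rw [← add_apply, ← mul_apply_eq_comp, Ring.mul_inverse_cancel _ (isUnit_fpow_add_fpow h0 h1 hZ),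
    one_apply_eq_self]

theorem cpow_norm_rotate_le (h0 : 0 < γ) (h1 : γ < 1) (hZ : ‖Z‖ ≤ 1) :
    ‖(Real.sin (Real.pi * γ / 2) : ℂ) • cpow γ Z + (Complex.I * (Real.cos (Real.pi * γ / 2) : ℂ)) •
        ContinuousLinearMap.id ℂ H‖ ≤ 1 ∧
    ‖(Real.sin (Real.pi * γ / 2) : ℂ) • cpow γ Z - (Complex.I * (Real.cos (Real.pi * γ / 2) : ℂ)) •
        ContinuousLinearMap.id ℂ H‖ ≤ 1 := by
  obtain ⟨hc, hs⟩ := cos_pos_sin_pos h0 h1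
  constructor <;> refine ContinuousLinearMap.opNorm_le_bound _ zero_le_one fun x => ?_ <;>
    obtain ⟨u, hu, hx⟩ := exists_cpow_apply h0 h1 hZ x <;>
    have h := norm_rotate_le (Real.sin_sq_add_cos_sq _) hs.le hc.le (sector_inner_fpow h0 h1 hZ u)
  · rw [add_apply, smul_apply, smul_apply, hx, ContinuousLinearMap.id_apply, one_mul, hu]
    exact h.1
  · rw [sub_apply, smul_apply, smul_apply, hx, ContinuousLinearMap.id_apply, one_mul, hu]
    exact h.2

theorem norm_cpow_le (h0 : 0 < γ) (h1 : γ < 1) (hZ : ‖Z‖ ≤ 1) : ‖cpow γ Z‖ ≤ 1 := by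
  obtain ⟨hc, hs⟩ := cos_pos_sin_pos h0 h1
  refine ContinuousLinearMap.opNorm_le_bound _ zero_le_one fun x => ?_
  obtain ⟨u, hu, hx⟩ := exists_cpow_apply h0 h1 hZ x
  have h := sector_inner_fpow h0 h1 hZ u
  have h2 : 0 ≤ (⟪fpow γ (1 - Z) u, fpow γ (1 + Z) u⟫_ℂ).re :=
    nonneg_of_mul_nonneg_right ((mul_nonneg hc.le (abs_nonneg _)).trans h) hs
  rw [hx, one_mul, hu]
  have h4 := norm_add_sq (𝕜 := ℂ) (fpow γ (1 + Z) u) (fpow γ (1 - Z) u)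
  have h5 := norm_sub_sq (𝕜 := ℂ) (fpow γ (1 + Z) u) (fpow γ (1 - Z) u)
  rw [← inner_conj_symm] at h4 h5
  simp only [RCLike.re_to_complex, Complex.conj_re] at h4 h5
  refine (sq_le_sq₀ (norm_nonneg _) (norm_nonneg _)).1 ?_
  linarith

/-- Through this factorization `1 + Z_γ` inherits injectivity from `(1 + Z)^γ`, and is invertible
exactly when that power is. -/
theorem one_add_cpow (h0 : 0 < γ) (h1 : γ < 1) (hZ : ‖Z‖ ≤ 1) :
    1 + cpow γ Z = (2 : ℂ) • (fpow γ (1 + Z) *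
      Ring.inverse (fpow γ (1 + Z) + fpow γ (1 - Z))) := by
  have hN := isUnit_fpow_add_fpow h0 h1 hZ
  rw [cpow]
  generalize fpow γ (1 + Z) = P at *
  generalize fpow γ (1 - Z) = Q at *
  rw [← Ring.mul_inverse_cancel _ hN, ← add_mul, ← smul_mul_assoc]
  congr 1
  module

theorem one_sub_cpow (h0 : 0 < γ) (h1 : γ < 1) (hZ : ‖Z‖ ≤ 1) :
    1 - cpow γ Z = (2 : ℂ) • (fpow γ (1 - Z) *
      Ring.inverse (fpow γ (1 + Z) + fpow γ (1 - Z))) := by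
  have hN := isUnit_fpow_add_fpow h0 h1 hZ
  rw [cpow]
  generalize fpow γ (1 + Z) = P at *
  generalize fpow γ (1 - Z) = Q at *
  rw [← Ring.mul_inverse_cancel _ hN, ← sub_mul, ← smul_mul_assoc]
  congr 1
  module

omit [CompleteSpace H] in
theorem isUnit_two_smul_mul_iff {A N : H →L[ℂ] H} (hN : IsUnit N) :
    IsUnit ((2 : ℂ) • (A * Ring.inverse N)) ↔ IsUnit A := by
  obtain ⟨u, rfl⟩ := hN
  rw [Ring.inverse_unit]
  exact (isUnit_smul_iff (Units.mk0 (2 : ℂ) two_ne_zero) _).trans (Units.isUnit_mul_units A u⁻¹)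

theorem isUnit_fpow_iff (h0 : 0 < γ) (h1 : γ < 1) {A : H →L[ℂ] H} (hA : Accretive A) :
    IsUnit (fpow γ A) ↔ IsUnit A :=
  ⟨isUnit_of_isUnit_fpow h0 h1 hA.nonneg, isUnit_fpow_of_isUnit h0 h1 hA⟩

theorem isUnit_one_add_cpow_iff (h0 : 0 < γ) (h1 : γ < 1) (hZ : ‖Z‖ ≤ 1) :
    IsUnit (1 + cpow γ Z) ↔ IsUnit (1 + Z) := by
  rw [one_add_cpow h0 h1 hZ, isUnit_two_smul_mul_iff (isUnit_fpow_add_fpow h0 h1 hZ),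
    isUnit_fpow_iff h0 h1 (accretive_one_add hZ)]

theorem isUnit_one_sub_cpow_iff (h0 : 0 < γ) (h1 : γ < 1) (hZ : ‖Z‖ ≤ 1) :
    IsUnit (1 - cpow γ Z) ↔ IsUnit (1 - Z) := by
  rw [one_sub_cpow h0 h1 hZ, isUnit_two_smul_mul_iff (isUnit_fpow_add_fpow h0 h1 hZ),
    isUnit_fpow_iff h0 h1 (accretive_one_sub hZ)]

theorem fpow_injective (h0 : 0 < γ) (h1 : γ < 1) {A : H →L[ℂ] H} (hA : Accretive A)
    (h : ∀ u, A u = 0 → u = 0) (u : H) (hu : fpow γ A u = 0) : u = 0 := by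
  obtain ⟨k, hk, hle⟩ := hA.exists_le_re_inner_fpow h0 h1
  have h2 := hle u
  rw [hu, inner_zero_right, Complex.zero_re] at h2
  refine h u (norm_eq_zero.1 (pow_eq_zero_iff two_ne_zero |>.1 ?_))
  exact le_antisymm (nonpos_of_mul_nonpos_right h2 hk) (sq_nonneg _)

omit [CompleteSpace H] in
theorem two_smul_mul_injective {A N : H →L[ℂ] H} (hN : IsUnit N) (hA : ∀ u, A u = 0 → u = 0)
    (u : H) (hu : ((2 : ℂ) • (A * Ring.inverse N)) u = 0) : u = 0 := by
  rw [smul_apply, smul_eq_zero, mul_apply_eq_comp] at hu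
  have h := congr_arg N (hA _ (hu.resolve_left two_ne_zero))
  rwa [← mul_apply_eq_comp, Ring.mul_inverse_cancel _ hN, one_apply_eq_self, map_zero] at h

end Contraction

/-! ### Consequences of the relation `Z* X = -X Z`. -/

namespace KatoPair

variable {X Z : H →L[ℂ] H}

theorem one_add_star_mul (h : KatoPair X Z) : (1 + star Z) * X = X * (1 - Z) := by
  rw [add_mul, mul_sub, h.star_mul_eq, one_mul, mul_one, sub_eq_add_neg]

theorem one_sub_star_mul (h : KatoPair X Z) : (1 - star Z) * X = X * (1 + Z) := by
  rw [sub_mul, mul_add, h.star_mul_eq, one_mul, mul_one, sub_neg_eq_add]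

/-- Moving `X` across exchanges the adjoint of `(1 + Z)^γ` with `(1 - Z)^γ` and vice versa. The sum
of the powers is symmetric under this exchange, the difference antisymmetric. -/
theorem star_cpow_mul (h0 : 0 < γ) (h1 : γ < 1) (h : KatoPair X Z) :
    star (FractionalPower.cpow γ Z) * X = -(X * FractionalPower.cpow γ Z) := by
  have hP := accretive_one_add h.norm_le
  have hQ := accretive_one_sub h.norm_le
  have hZs : ‖star Z‖ ≤ 1 := (norm_star Z).trans_le h.norm_le
  have e1 : star (fpow γ (1 + Z)) * X = X * fpow γ (1 - Z) := by
    rw [star_fpow, star_add, star_one]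
    exact fpow_mul_of_mul_eq h0 h1 (accretive_one_add hZs).nonneg hQ.nonneg h.one_add_star_mul
  have e2 : star (fpow γ (1 - Z)) * X = X * fpow γ (1 + Z) := by
    rw [star_fpow, star_sub, star_one]
    exact fpow_mul_of_mul_eq h0 h1 (accretive_one_sub hZs).nonneg hP.nonneg h.one_sub_star_mul
  have hc : Commute (fpow γ (1 + Z)) (fpow γ (1 - Z)) := by
    refine commute_fpow h0 h1 hQ.nonneg (commute_fpow h0 h1 hP.nonneg ?_).symm
    exact ((Commute.one_left _).sub_left ((Commute.one_right Z).add_right (Commute.refl Z)))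
  have hN := isUnit_fpow_add_fpow h0 h1 h.norm_le
  rw [FractionalPower.cpow]
  generalize fpow γ (1 + Z) = P at *
  generalize fpow γ (1 - Z) = Q at *
  have e3 : star (P + Q) * X = X * (P + Q) := by
    rw [star_add, add_mul, mul_add, e1, e2, add_comm]
  have e4 : star (P - Q) * X = -(X * (P - Q)) := by
    rw [star_sub, sub_mul, mul_sub, e1, e2, neg_sub]
  have e5 : Ring.inverse (star (P + Q)) * X = X * Ring.inverse (P + Q) := by
    rw [Ring.inverse_mul_eq_iff_eq_mul _ _ _ hN.star, ← mul_assoc,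
      Ring.eq_mul_inverse_iff_mul_eq _ _ _ hN, ← e3]
  have e6 : Commute (P - Q) (Ring.inverse (P + Q)) := commute_ringInverse_right
    (((Commute.refl P).add_right hc).sub_left (hc.symm.add_right (Commute.refl Q)))
  rw [star_mul, ← Ring.inverse_star, mul_assoc, e4, mul_neg, ← mul_assoc, e5, mul_assoc, e6.eq]

theorem cpow (h0 : 0 < γ) (h1 : γ < 1) (h : KatoPair X Z) :
    KatoPair X (FractionalPower.cpow γ Z) where
  star_eq := h.star_eq
  accretive := h.accretive
  injective := h.injective
  norm_le := norm_cpow_le h0 h1 h.norm_le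
  star_mul_eq := h.star_cpow_mul h0 h1
  injective_add u hu := by
    rw [one_add_cpow h0 h1 h.norm_le] at hu
    exact two_smul_mul_injective (isUnit_fpow_add_fpow h0 h1 h.norm_le)
      (fpow_injective h0 h1 (accretive_one_add h.norm_le) h.injective_add) u hu
  injective_sub u hu := by
    rw [one_sub_cpow h0 h1 h.norm_le] at hu
    exact two_smul_mul_injective (isUnit_fpow_add_fpow h0 h1 h.norm_le)
      (fpow_injective h0 h1 (accretive_one_sub h.norm_le) h.injective_sub) u hu

theorem star_mul_one_add (h : KatoPair X Z) : star (X * (1 + Z)) = X * (1 - Z) := by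
  rw [star_mul, h.star_eq, star_add, star_one, h.one_add_star_mul]

theorem add_star (h : KatoPair X Z) : X * (1 + Z) + star (X * (1 + Z)) = (2 : ℂ) • X := by
  rw [h.star_mul_one_add, mul_add, mul_sub, mul_one]
  module

theorem accretive_mul (h : KatoPair X Z) : Accretive (X * (1 + Z)) := fun u => by
  have h1 := congr_arg (fun A : H →L[ℂ] H => (⟪u, A u⟫_ℂ).re) h.add_star
  simp only [add_apply, inner_add_right, Complex.add_re, smul_apply, inner_smul_right,
    inner_star_right] at h1
  rw [← inner_conj_symm ((X * (1 + Z)) u), Complex.conj_re,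
    show (2 : ℂ) = ((2 : ℝ) : ℂ) by norm_num, Complex.re_ofReal_mul] at h1
  linarith [h.accretive u]

theorem mul_injective (h : KatoPair X Z) (u : H) (hu : (X * (1 + Z)) u = 0) : u = 0 :=
  h.injective_add u (h.injective _ hu)

theorem star_mul_injective (h : KatoPair X Z) (u : H) (hu : star (X * (1 + Z)) u = 0) :
    u = 0 := by
  rw [h.star_mul_one_add] at hu
  exact h.injective_sub u (h.injective _ hu)

/-- For `T = X (1 + Z)` this is `⟪T* u, T u⟫`, with `T* = (1 + Z*) X` and `T = (1 - Z*) X`. The form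
of `T²` is thereby expressed through the contraction `Z*` alone, at the vector `X u`. -/
theorem inner_mul_mul (h : KatoPair X Z) (u : H) :
    ⟪u, (X * (1 + Z) * (X * (1 + Z))) u⟫_ℂ = ⟪X u + star Z (X u), X u - star Z (X u)⟫_ℂ := by
  rw [mul_apply_eq_comp, ← inner_star_left, h.star_mul_one_add, ← h.one_add_star_mul,
    ← h.one_sub_star_mul]
  rfl

omit [CompleteSpace H] in
theorem _root_.FractionalPower.re_inner_add_sub (x y : H) :
    (⟪x + y, x - y⟫_ℂ).re = ‖x‖ ^ 2 - ‖y‖ ^ 2 ∧ (⟪x + y, x - y⟫_ℂ).im = -2 * (⟪x, y⟫_ℂ).im := by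
  rw [inner_add_left, inner_sub_right, inner_sub_right, inner_self_ofReal, inner_self_ofReal,
    ← inner_conj_symm y x]
  simp only [Complex.sub_re, Complex.add_re, Complex.conj_re, Complex.ofReal_re, Complex.sub_im,
    Complex.add_im, Complex.conj_im, Complex.ofReal_im]
  constructor <;> ring

theorem accretive_sq (h : KatoPair X Z) : Accretive (X * (1 + Z) * (X * (1 + Z))) := fun u => by
  rw [h.inner_mul_mul, (re_inner_add_sub _ _).1]
  have h1 := (star Z).le_of_opNorm_le ((norm_star Z).trans_le h.norm_le) (X u)
  rw [one_mul] at h1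
  exact sub_nonneg.2 (pow_le_pow_left₀ (norm_nonneg _) h1 2)

theorem fpow_half_sq (h : KatoPair X Z) :
    fpow (1 / 2) (X * (1 + Z) * (X * (1 + Z))) = X * (1 + Z) :=
  fpow_half_mul_self_eq h.accretive_mul h.accretive_sq fun u hu => by
    rw [h.add_star, smul_apply, smul_eq_zero] at hu
    exact h.injective u (hu.resolve_left two_ne_zero)

/-- The sector of the square, for a contraction in the class `C(α)`. -/
theorem sector_sq (h : KatoPair X Z) {s c : ℝ} (hsc : s ^ 2 + c ^ 2 = 1) (hs : 0 < s)
    (h1 : ‖(s : ℂ) • Z + (Complex.I * (c : ℂ)) • ContinuousLinearMap.id ℂ H‖ ≤ 1)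
    (h2 : ‖(s : ℂ) • Z - (Complex.I * (c : ℂ)) • ContinuousLinearMap.id ℂ H‖ ≤ 1) (u : H) :
    |c * (⟪u, (X * (1 + Z) * (X * (1 + Z))) u⟫_ℂ).im| ≤
      s * (⟪u, (X * (1 + Z) * (X * (1 + Z))) u⟫_ℂ).re := by
  rw [h.inner_mul_mul, (re_inner_add_sub _ _).1, (re_inner_add_sub _ _).2]
  generalize X u = x
  have hid : star (ContinuousLinearMap.id ℂ H) = ContinuousLinearMap.id ℂ H := star_one (H →L[ℂ] H)
  rw [← norm_star] at h1 h2
  rw [star_add, star_smul, star_smul, hid, star_mul] at h1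
  rw [star_sub, star_smul, star_smul, hid, star_mul] at h2
  have g1 := ContinuousLinearMap.le_of_opNorm_le _ h1 x
  have g2 := ContinuousLinearMap.le_of_opNorm_le _ h2 x
  rw [one_mul] at g1 g2
  have f1 := pow_le_pow_left₀ (norm_nonneg _) g1 2
  have f2 := pow_le_pow_left₀ (norm_nonneg _) g2 2
  simp only [add_apply, sub_apply, smul_apply, ContinuousLinearMap.id_apply, RCLike.star_def,
    Complex.conj_ofReal, Complex.conj_I] at f1 f2
  rw [norm_add_sq (𝕜 := ℂ)] at f1
  rw [norm_sub_sq (𝕜 := ℂ)] at f2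
  have e : (⟪(s : ℂ) • star Z x, ((c : ℂ) * -Complex.I) • x⟫_ℂ).re =
      -(s * c * (⟪x, star Z x⟫_ℂ).im) := by
    rw [inner_smul_left, inner_smul_right, Complex.conj_ofReal, Complex.re_ofReal_mul, mul_assoc,
      Complex.re_ofReal_mul, neg_mul, Complex.neg_re, Complex.I_mul_re, ← inner_conj_symm,
      Complex.conj_im]
    ring
  simp only [RCLike.re_to_complex, e, norm_smul, mul_pow, norm_mul, norm_neg, Complex.norm_I,
    Complex.norm_real, Real.norm_eq_abs, sq_abs, mul_one] at f1 f2
  -- With this substitution the squared norm bounds read `±2 s c Im ⟪x, Z* x⟫ ≤ s² (‖x‖² - ‖Z*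
  -- x‖²)`, and one factor `s > 0` cancels.
  have h9 : c ^ 2 = 1 - s ^ 2 := by linarith
  rw [h9] at f1 f2
  rw [abs_le]
  constructor <;> refine le_of_mul_le_mul_left ?_ hs <;> linarith

/-- Injectivity of `X` reduces to the ranges of `1 + Z` and `1 - Z`. These ranges together span the
space because the operators add up to `2`; if they coincide, each is everything. -/
theorem range_eq_iff (h : KatoPair X Z) :
    range ⇑(X * (1 + Z)) = range ⇑(X * (1 - Z)) ↔ IsUnit (1 + Z) ∧ IsUnit (1 - Z) := by
  have hXi : Function.Injective X := (injective_iff_map_eq_zero X).2 h.injective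
  have e1 : range ⇑(X * (1 + Z)) = X '' range ⇑(1 + Z) := range_comp X ⇑(1 + Z)
  have e2 : range ⇑(X * (1 - Z)) = X '' range ⇑(1 - Z) := range_comp X ⇑(1 - Z)
  rw [e1, e2, hXi.image_injective.eq_iff, ContinuousLinearMap.isUnit_iff_bijective,
    ContinuousLinearMap.isUnit_iff_bijective]
  constructor
  · intro he
    have hsum : ∀ u, u = (1 + Z) ((1 / 2 : ℂ) • u) + (1 - Z) ((1 / 2 : ℂ) • u) := fun u => by
      rw [add_apply, sub_apply, one_apply_eq_self]
      module
    refine ⟨⟨(injective_iff_map_eq_zero _).2 h.injective_add, fun u => ?_⟩,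
      ⟨(injective_iff_map_eq_zero _).2 h.injective_sub, fun u => ?_⟩⟩
    · obtain ⟨v, hv⟩ := he.symm ▸ mem_range_self (f := ⇑(1 - Z)) ((1 / 2 : ℂ) • u)
      exact ⟨(1 / 2 : ℂ) • u + v, by rw [map_add, hv, ← hsum]⟩
    · obtain ⟨v, hv⟩ := he ▸ mem_range_self (f := ⇑(1 + Z)) ((1 / 2 : ℂ) • u)
      exact ⟨v + (1 / 2 : ℂ) • u, by rw [map_add, hv, ← hsum]⟩
  · rintro ⟨h1, h2⟩
    rw [h1.2.range_eq, h2.2.range_eq]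

end KatoPair

end

section

/-! ### Calculus of graphs for bounded operators and their inverses. -/

section Graph

variable {H : Type*} [NormedAddCommGroup H] [InnerProductSpace ℂ H]

theorem pmap_ext {f g : H →ₗ.[ℂ] H} (h : ∀ x y, (x, y) ∈ f.graph ↔ (x, y) ∈ g.graph) : f = g :=
  LinearPMap.eq_of_eq_graph (Submodule.ext fun p => h p.1 p.2)

theorem mem_graph_inverse {f : H →ₗ.[ℂ] H} (hf : f.IsInjective) {x y : H} :
    (x, y) ∈ f.inverse.graph ↔ (y, x) ∈ f.graph := by
  have hk : LinearMap.ker f.toFun = ⊥ :=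
    LinearMap.ker_eq_bot'.2 fun u hu => Subtype.ext (hf u hu)
  rw [LinearPMap.inverse_graph hk, Submodule.mem_map]
  constructor
  · rintro ⟨⟨a, b⟩, h, e⟩
    obtain ⟨rfl, rfl⟩ := Prod.mk.inj e
    exact h
  · exact fun h => ⟨(y, x), h, rfl⟩

theorem isInjective_iff {f : H →ₗ.[ℂ] H} :
    f.IsInjective ↔ ∀ x, (x, (0 : H)) ∈ f.graph → x = 0 := by
  constructor
  · intro h x hx
    obtain ⟨u, rfl, hu⟩ := f.mem_graph_iff.1 hx
    exact h u hu
  · intro h u hu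
    exact h u (f.mem_graph_iff.2 ⟨u, rfl, hu⟩)

theorem isInjective_inverse {f : H →ₗ.[ℂ] H} (hf : f.IsInjective) : f.inverse.IsInjective :=
  isInjective_iff.2 fun _ hx => f.graph_fst_eq_zero_snd ((mem_graph_inverse hf).1 hx) rfl

theorem inverse_inverse {f : H →ₗ.[ℂ] H} (hf : f.IsInjective) : f.inverse.inverse = f :=
  pmap_ext fun _ _ => (mem_graph_inverse (isInjective_inverse hf)).trans (mem_graph_inverse hf)

theorem mem_graph_add {f g : H →ₗ.[ℂ] H} {x z : H} :
    (x, z) ∈ (f + g).graph ↔ ∃ a b, (x, a) ∈ f.graph ∧ (x, b) ∈ g.graph ∧ z = a + b := by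
  constructor
  · intro h
    obtain ⟨u, rfl, rfl⟩ := (LinearPMap.mem_graph_iff _).1 h
    exact ⟨_, _, f.mem_graph ⟨u, u.2.1⟩, g.mem_graph ⟨u, u.2.2⟩, rfl⟩
  · rintro ⟨a, b, h1, h2, rfl⟩
    obtain ⟨⟨_, hu⟩, rfl, rfl⟩ := f.mem_graph_iff.1 h1
    obtain ⟨⟨_, hv⟩, rfl, rfl⟩ := g.mem_graph_iff.1 h2
    exact (LinearPMap.mem_graph_iff _).2 ⟨⟨_, hu, hv⟩, rfl, rfl⟩

theorem mem_graph_smul {f : H →ₗ.[ℂ] H} {c : ℂ} {x z : H} :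
    (x, z) ∈ (c • f).graph ↔ ∃ a, (x, a) ∈ f.graph ∧ z = c • a := by
  constructor
  · intro h
    obtain ⟨u, rfl, rfl⟩ := (LinearPMap.mem_graph_iff _).1 h
    exact ⟨_, f.mem_graph u, rfl⟩
  · rintro ⟨a, h, rfl⟩
    obtain ⟨u, rfl, rfl⟩ := f.mem_graph_iff.1 h
    exact (LinearPMap.mem_graph_iff _).2 ⟨u, rfl, rfl⟩

theorem mem_graph_neg {f : H →ₗ.[ℂ] H} {x z : H} :
    (x, z) ∈ (-f).graph ↔ ∃ a, (x, a) ∈ f.graph ∧ z = -a := by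
  constructor
  · intro h
    obtain ⟨u, rfl, rfl⟩ := (LinearPMap.mem_graph_iff _).1 h
    exact ⟨_, f.mem_graph u, rfl⟩
  · rintro ⟨a, h, rfl⟩
    obtain ⟨u, rfl, rfl⟩ := f.mem_graph_iff.1 h
    exact (LinearPMap.mem_graph_iff _).2 ⟨u, rfl, rfl⟩

theorem closure_eq_of_graph {f g : H →ₗ.[ℂ] H} (h : f.graph.topologicalClosure = g.graph) :
    f.closure = g :=
  LinearPMap.eq_of_eq_graph
    ((LinearPMap.IsClosable.graph_closure_eq_closure_graph ⟨g, h⟩).symm.trans h)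

/-- A bounded operator as an operator with domain `⊤`. -/
def bdd (W : H →L[ℂ] H) : H →ₗ.[ℂ] H := (W : H →ₗ[ℂ] H).toPMap ⊤

theorem mem_graph_bdd {W : H →L[ℂ] H} {x y : H} : (x, y) ∈ (bdd W).graph ↔ y = W x := by
  constructor
  · intro h
    obtain ⟨u, rfl, rfl⟩ := (LinearPMap.mem_graph_iff _).1 h
    rfl
  · rintro rfl
    exact (LinearPMap.mem_graph_iff _).2 ⟨⟨x, Submodule.mem_top⟩, rfl, rfl⟩

theorem isInjective_bdd {W : H →L[ℂ] H} : (bdd W).IsInjective ↔ ∀ u, W u = 0 → u = 0 := by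
  simp only [isInjective_iff, mem_graph_bdd, eq_comm]

theorem mem_graph_bdd_inverse {W : H →L[ℂ] H} (hW : ∀ u, W u = 0 → u = 0) {x y : H} :
    (x, y) ∈ (bdd W).inverse.graph ↔ x = W y :=
  (mem_graph_inverse (isInjective_bdd.2 hW)).trans mem_graph_bdd

theorem domain_bdd_inverse {W : H →L[ℂ] H} (hW : ∀ u, W u = 0 → u = 0) :
    ((bdd W).inverse.domain : Set H) = range W := by
  ext x
  rw [SetLike.mem_coe, LinearPMap.mem_domain_iff]
  exact exists_congr fun y => (mem_graph_bdd_inverse hW).trans eq_comm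

theorem idOp_eq_bdd : LinearPMap.idOp H = bdd 1 := rfl

theorem bdd_add (V W : H →L[ℂ] H) : bdd V + bdd W = bdd (V + W) := pmap_ext fun x z => by
  simp only [mem_graph_add, mem_graph_bdd, exists_and_left, exists_eq_left, add_apply]

theorem bdd_neg (W : H →L[ℂ] H) : -bdd W = bdd (-W) := pmap_ext fun x z => by
  simp only [mem_graph_neg, mem_graph_bdd, exists_eq_left, neg_apply]

theorem bdd_sub (V W : H →L[ℂ] H) : bdd V - bdd W = bdd (V - W) := by
  rw [sub_eq_add_neg, sub_eq_add_neg, bdd_neg, bdd_add]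

theorem bdd_smul (c : ℂ) (W : H →L[ℂ] H) : c • bdd W = bdd (c • W) := pmap_ext fun x z => by
  simp only [mem_graph_smul, mem_graph_bdd, exists_eq_left, smul_apply]

theorem bdd_pcomp (V W : H →L[ℂ] H) : (bdd V).pcomp (bdd W) = bdd (V * W) := pmap_ext fun x z => by
  simp only [LinearPMap.mem_graph_pcomp, mem_graph_bdd, exists_eq_left, mul_apply_eq_comp]

theorem bdd_inverse_eq_of_isUnit {W : H →L[ℂ] H} (h : IsUnit W) :
    (bdd W).inverse = bdd (Ring.inverse W) := by
  have h1 : ∀ x, W (Ring.inverse W x) = x := fun x => by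
    rw [← mul_apply_eq_comp, Ring.mul_inverse_cancel _ h, one_apply_eq_self]
  have h2 : ∀ x, Ring.inverse W (W x) = x := fun x => by
    rw [← mul_apply_eq_comp, Ring.inverse_mul_cancel _ h, one_apply_eq_self]
  have hW : ∀ u, W u = 0 → u = 0 := fun u hu => by rw [← h2 u, hu, map_zero]
  refine pmap_ext fun x y => ?_
  rw [mem_graph_bdd_inverse hW, mem_graph_bdd]
  exact ⟨fun h => by rw [h, h2], fun h => by rw [h, h1]⟩

theorem bdd_inverse_pcomp_inverse {V W : H →L[ℂ] H} (hV : ∀ u, V u = 0 → u = 0)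
    (hW : ∀ u, W u = 0 → u = 0) : (bdd V).inverse.pcomp (bdd W).inverse = (bdd (W * V)).inverse :=
  pmap_ext fun x z => by
    rw [LinearPMap.mem_graph_pcomp, mem_graph_bdd_inverse (W := W * V) fun u hu => hV u (hW _ hu)]
    simp only [mem_graph_bdd_inverse hV, mem_graph_bdd_inverse hW, exists_eq_right,
      mul_apply_eq_comp]

variable [CompleteSpace H]

theorem bdd_adjoint (W : H →L[ℂ] H) : (bdd W).adjoint = bdd (star W) :=
  W.toPMap_adjoint_eq_adjoint_toPMap_of_dense (p := ⊤) dense_univ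

/-- Injectivity of `star W` makes the domain `range W` dense, which identifies the graph of the
adjoint with the adjoint graph. -/
theorem bdd_inverse_adjoint {W : H →L[ℂ] H} (hW : ∀ u, W u = 0 → u = 0)
    (hW' : ∀ u, star W u = 0 → u = 0) : (bdd W).inverse.adjoint = (bdd (star W)).inverse := by
  refine pmap_ext fun x y => ?_
  have hd : Dense ((bdd W).inverse.domain : Set H) := by
    rw [domain_bdd_inverse hW]
    exact denseRange_of_star_injective hW'
  rw [LinearPMap.adjoint_graph_eq_graph_adjoint hd, Submodule.mem_adjoint_iff,
    mem_graph_bdd_inverse hW']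
  simp only [mem_graph_bdd_inverse hW]
  constructor
  · intro h
    refine ext_inner_left ℂ fun v => ?_
    rw [inner_star_right]
    exact sub_eq_zero.1 (h _ v rfl)
  · rintro rfl a b rfl
    rw [inner_star_right, sub_self]

end Graph

/-! ### Fractional powers of bounded operators, and square roots of their inverses. -/

section Powers

variable {H : Type*} [NormedAddCommGroup H] [InnerProductSpace ℂ H] [CompleteSpace H] {γ : ℝ}

theorem fpow_apply (h0 : 0 < γ) (h1 : γ < 1) {A : H →L[ℂ] H} {M : ℝ} (hA : Nonneg A M) (x : H) :
    IntegrableOn (fun t : ℝ => ((t ^ (γ - 1) : ℝ) : ℂ) • yosida A t x) (Ioi 0) ∧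
    fpow γ A x = ((Real.sin (γ * Real.pi) / Real.pi : ℝ) : ℂ) •
      ∫ t in Ioi (0 : ℝ), ((t ^ (γ - 1) : ℝ) : ℂ) • yosida A t x := by
  have hi := hA.integrableOn h0 h1
  refine ⟨(ContinuousLinearMap.apply ℂ H x).integrable_comp hi, ?_⟩
  rw [fpow, smul_apply, ContinuousLinearMap.integral_apply hi]
  rfl

omit [CompleteSpace H] in
theorem graph_balakrishnan (A : H →ₗ.[ℂ] H) :
    (A.balakrishnanGraph γ).toLinearPMap.graph = A.balakrishnanGraph γ :=
  Submodule.toLinearPMap_graph_eq _ fun p => A.balakrishnanGraph_functional γ p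

omit [CompleteSpace H] in
/-- If `A (A + t)⁻¹ x = g t` for `t > 0` then the Balakrishnan operator at `x` is given by the
integral of `g`. -/
theorem mem_balakrishnanGraph_iff {A : H →ₗ.[ℂ] H} {x y : H} (hx : x ∈ A.domain) {g : ℝ → H}
    (hg : ∀ t : ℝ, 0 < t → ∀ z,
      (x, z) ∈ (A.pcomp (A + (t : ℂ) • LinearPMap.idOp H).inverse).graph ↔ z = g t)
    (hi : IntegrableOn (fun t : ℝ => ((t ^ (γ - 1) : ℝ) : ℂ) • g t) (Ioi 0)) :
    (x, y) ∈ A.balakrishnanGraph γ ↔ y = ((Real.sin (γ * Real.pi) / Real.pi : ℝ) : ℂ) •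
      ∫ t in Ioi (0 : ℝ), ((t ^ (γ - 1) : ℝ) : ℂ) • g t := by
  constructor
  · rintro ⟨-, k, hk, -, h⟩
    refine h.trans (congr_arg _ (setIntegral_congr_fun measurableSet_Ioi fun t ht => ?_))
    simp only [(hg t ht _).1 (hk t ht)]
  · exact fun h => ⟨hx, g, fun t ht => (hg t ht _).2 rfl, hi, h⟩

/-- The Balakrishnan operator is already everywhere defined and bounded, so its graph is closed and
the closure adds nothing. -/
theorem fracPow_bdd (h0 : 0 < γ) (h1 : γ < 1) {A : H →L[ℂ] H} (hA : Accretive A) :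
    (bdd A).fracPow γ = bdd (fpow γ A) := by
  have key : (bdd A).balakrishnanGraph γ = (bdd (fpow γ A)).graph := by
    ext ⟨x, y⟩
    obtain ⟨hi, he⟩ := fpow_apply h0 h1 hA.nonneg x
    rw [mem_graph_bdd, he]
    refine mem_balakrishnanGraph_iff Submodule.mem_top (fun t ht z => ?_) hi
    rw [idOp_eq_bdd, bdd_smul, bdd_add, bdd_inverse_eq_of_isUnit (hA.nonneg.isUnit t ht),
      bdd_pcomp, mem_graph_bdd]
    rfl
  refine closure_eq_of_graph ?_
  rw [graph_balakrishnan, key]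
  refine IsClosed.submodule_topologicalClosure_eq ?_
  have : ((bdd (fpow γ A)).graph : Set (H × H)) = {p | p.2 = fpow γ A p.1} := by
    ext ⟨x, y⟩
    exact mem_graph_bdd
  rw [this]
  exact isClosed_eq continuous_snd ((fpow γ A).continuous.comp continuous_fst)

/-- For `A = R⁻¹` the vector `w = A (A + t)⁻¹ R v` is the solution of `w + t R w = R v`, that is `w
= t⁻¹ R (R + t⁻¹)⁻¹ v`. -/
theorem mem_graph_inverse_yosida {R : H →L[ℂ] H} (hR : Accretive R) (hinj : ∀ u, R u = 0 → u = 0)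
    {t : ℝ} (ht : 0 < t) (v z : H) :
    (R v, z) ∈ ((bdd R).inverse.pcomp
      ((bdd R).inverse + (t : ℂ) • LinearPMap.idOp H).inverse).graph ↔
      z = ((t⁻¹ : ℝ) : ℂ) • yosida R t⁻¹ v := by
  have htc : (t : ℂ) ≠ 0 := Complex.ofReal_ne_zero.2 ht.ne'
  have hu := hR.nonneg.isUnit t⁻¹ (inv_pos.2 ht)
  have hsum : ∀ x y : H, (x, y) ∈ ((bdd R).inverse + (t : ℂ) • LinearPMap.idOp H).graph ↔
      ∃ w, x = R w ∧ y = w + (t : ℂ) • R w := fun x y => by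
    rw [idOp_eq_bdd, bdd_smul, mem_graph_add]
    simp only [mem_graph_bdd_inverse hinj, mem_graph_bdd]
    constructor
    · rintro ⟨w, _, rfl, rfl, rfl⟩
      exact ⟨w, rfl, rfl⟩
    · rintro ⟨w, rfl, rfl⟩
      exact ⟨w, _, rfl, rfl, rfl⟩
  have hcancel : ∀ w, w + (t : ℂ) • R w = 0 → w = 0 := fun w hw => by
    have h1 : (R + ((t⁻¹ : ℝ) : ℂ) • 1) w = 0 := by
      have := congr_arg (fun x => (t : ℂ)⁻¹ • x) hw
      simp only [smul_add, smul_smul, inv_mul_cancel₀ htc, one_smul, smul_zero] at this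
      rw [add_apply, smul_apply, one_apply_eq_self, Complex.ofReal_inv, add_comm]
      exact this
    rw [← one_apply_eq_self (F := H →L[ℂ] H) w, ← Ring.inverse_mul_cancel _ hu,
      mul_apply_eq_comp, h1, map_zero]
  have hS : ((bdd R).inverse + (t : ℂ) • LinearPMap.idOp H).IsInjective := by
    rw [isInjective_iff]
    intro x hx
    obtain ⟨w, rfl, hw⟩ := (hsum _ _).1 hx
    rw [hcancel w hw.symm, map_zero]
  have hsol : ((t⁻¹ : ℝ) : ℂ) • yosida R t⁻¹ v +
      (t : ℂ) • R (((t⁻¹ : ℝ) : ℂ) • yosida R t⁻¹ v) = R v := by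
    obtain ⟨u, hv, hy⟩ := exists_yosida_apply_eq hu v
    rw [hy, map_smul, smul_smul, Complex.ofReal_inv, mul_inv_cancel₀ htc, one_smul, hv, map_add,
      map_smul, Complex.ofReal_inv, add_comm]
  rw [LinearPMap.mem_graph_pcomp]
  simp only [mem_graph_inverse hS, hsum, mem_graph_bdd_inverse hinj]
  constructor
  · rintro ⟨_, ⟨w, rfl, hw⟩, hz⟩
    have hzw : z = w := sub_eq_zero.1 (hinj _ (by rw [map_sub, hz, sub_self]))
    subst hzw
    refine sub_eq_zero.1 (hcancel _ ?_)
    rw [map_sub, smul_sub, sub_add_sub_comm, hsol, ← hw, sub_self]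
  · rintro rfl
    exact ⟨_, ⟨_, rfl, hsol.symm⟩, rfl⟩

/-- The Jacobian and weight under `t ↦ 1 / t`: at exponent `1/2` the substitution turns the integral
for `R` into the one for `R⁻¹`, with the same normalizing constant. -/
theorem inverse_weight {t : ℝ} (ht : 0 < t) :
    |(-1 : ℝ)| * t ^ ((-1 : ℝ) - 1) * (t ^ (-1 : ℝ)) ^ ((1 / 2 : ℝ) - 1) =
      t ^ ((1 / 2 : ℝ) - 1) * t⁻¹ := by
  rw [abs_neg, abs_one, one_mul, ← Real.rpow_mul ht.le, ← Real.rpow_add ht, ← Real.rpow_neg_one,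
    ← Real.rpow_add ht]
  norm_num

/-- The square root of the inverse of a bounded accretive operator. -/
theorem sqrtOp_bdd_inverse {R : H →L[ℂ] H} (hR : Accretive R) (hinj : ∀ u, R u = 0 → u = 0) :
    (bdd R).inverse.sqrtOp = (bdd (fpow (1 / 2) R)).inverse := by
  have hh0 : (0 : ℝ) < 1 / 2 := by norm_num
  have hh1 : (1 / 2 : ℝ) < 1 := by norm_num
  have hS2 := hR.fpow_half_mul_self
  have hSinj := fpow_injective hh0 hh1 hR hinj
  have hSacc := hR.fpow hh0 hh1
  have key : ∀ v y, (R v, y) ∈ (bdd R).inverse.balakrishnanGraph (1 / 2) ↔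
      y = fpow (1 / 2) R v := fun v y => by
    obtain ⟨hi, he⟩ := fpow_apply hh0 hh1 hR.nonneg v
    have hfun : ∀ t ∈ Ioi (0 : ℝ), (|(-1 : ℝ)| * t ^ ((-1 : ℝ) - 1)) •
        (((t ^ (-1 : ℝ)) ^ ((1 / 2 : ℝ) - 1) : ℝ) : ℂ) • yosida R (t ^ (-1 : ℝ)) v =
        ((t ^ ((1 / 2 : ℝ) - 1) : ℝ) : ℂ) • ((t⁻¹ : ℝ) : ℂ) • yosida R t⁻¹ v := fun t ht => by
      rw [← Complex.coe_smul, smul_smul, smul_smul, ← Complex.ofReal_mul,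
        ← Complex.ofReal_mul, inverse_weight ht, Real.rpow_neg_one]
    rw [he, ← integral_comp_rpow_Ioi _ (neg_ne_zero.2 one_ne_zero : (-1 : ℝ) ≠ 0),
      setIntegral_congr_fun measurableSet_Ioi hfun]
    refine mem_balakrishnanGraph_iff ?_ (fun t ht z => mem_graph_inverse_yosida hR hinj ht v z) ?_
    · exact LinearPMap.mem_domain_iff.2 ⟨v, (mem_graph_bdd_inverse hinj).2 rfl⟩
    · exact (integrableOn_congr_fun hfun measurableSet_Ioi).1
        ((integrableOn_Ioi_comp_rpow_iff _ (neg_ne_zero.2 one_ne_zero : (-1 : ℝ) ≠ 0)).2 hi)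
  refine closure_eq_of_graph ?_
  rw [graph_balakrishnan]
  refine le_antisymm (Submodule.topologicalClosure_minimal _ ?_ ?_) ?_
  · rintro ⟨x, y⟩ hxy
    obtain ⟨v, hv⟩ := LinearPMap.mem_domain_iff.1 hxy.1
    obtain rfl : x = R v := (mem_graph_bdd_inverse hinj).1 hv
    rw [mem_graph_bdd_inverse hSinj, (key v y).1 hxy, ← mul_apply_eq_comp, hS2]
  · have : ((bdd (fpow (1 / 2) R)).inverse.graph : Set (H × H)) =
        {p | p.1 = fpow (1 / 2) R p.2} := by
      ext ⟨x, y⟩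
      exact mem_graph_bdd_inverse hSinj
    rw [this]
    exact isClosed_eq continuous_fst ((fpow (1 / 2) R).continuous.comp continuous_snd)
  · rintro ⟨x, y⟩ hxy
    obtain rfl := (mem_graph_bdd_inverse hSinj).1 hxy
    -- The Balakrishnan graph contains all points `(S (S v), S v)`, as `S (S v) = R v` lies in the
    -- domain. Density of the range of `S` gives the whole graph of `S⁻¹` in the closure.
    have hm : MapsTo (fun w => (fpow (1 / 2) R w, w)) (range ⇑(fpow (1 / 2) R))
        ((bdd R).inverse.balakrishnanGraph (1 / 2)) := by
      rintro _ ⟨v, rfl⟩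
      change (fpow (1 / 2) R (fpow (1 / 2) R v), fpow (1 / 2) R v) ∈ _
      rw [← mul_apply_eq_comp, hS2]
      exact (key v _).2 rfl
    exact map_mem_closure (f := fun w => (fpow (1 / 2) R w, w)) (by fun_prop)
      (hSacc.denseRange hSinj y) hm

end Powers

end

/-! ### Reduction of the unbounded problem to bounded operators. -/

section

variable {H : Type*} [NormedAddCommGroup H] [InnerProductSpace ℂ H] {γ : ℝ}

/-- Were `|arg z| > α`, then `sin (|arg z| - α)` would be positive, and its expansion by the
addition formula contradicts the hypothesis. -/
theorem abs_arg_le_of_mul_abs_im_le {z : ℂ} {α : ℝ} (h0 : 0 < α) (h1 : α < Real.pi / 2)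
    (h : |Real.cos α * z.im| ≤ Real.sin α * z.re) : |z.arg| ≤ α := by
  rcases eq_or_ne z 0 with rfl | hz
  · rw [Complex.arg_zero, abs_zero]
    exact h0.le
  have hc : 0 < Real.cos α := Real.cos_pos_of_mem_Ioo ⟨by linarith, h1⟩
  have hn := norm_pos_iff.2 hz
  by_contra! hlt
  have hs : 0 < Real.sin (|z.arg| - α) :=
    Real.sin_pos_of_pos_of_lt_pi (by linarith) (by linarith [Complex.abs_arg_le_pi z])
  have hsin : Real.sin |z.arg| = |z.im| / ‖z‖ := by
    rw [← Real.abs_sin_eq_sin_abs_of_abs_le_pi (Complex.abs_arg_le_pi z), Complex.sin_arg, abs_div,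
      abs_norm]
  rw [Real.sin_sub, hsin, Real.cos_abs, Complex.cos_arg hz] at hs
  rw [abs_mul, abs_of_pos hc] at h
  have e : |z.im| / ‖z‖ * Real.cos α - z.re / ‖z‖ * Real.sin α =
      (Real.cos α * |z.im| - Real.sin α * z.re) / ‖z‖ := by ring
  rw [e] at hs
  exact absurd ((div_pos_iff_of_pos_right hn).1 hs) (by linarith)

theorem bdd_inverse_pcomp {X V Y : H →L[ℂ] H} (hX : ∀ u, X u = 0 → u = 0) (h : V = X * Y) :
    (bdd X).inverse.pcomp (bdd V) = bdd Y := pmap_ext fun x z => by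
  simp only [LinearPMap.mem_graph_pcomp, mem_graph_bdd_inverse hX, mem_graph_bdd, exists_eq_left]
  rw [h, mul_apply_eq_comp, ← sub_eq_zero, ← map_sub]
  exact ⟨fun e => (sub_eq_zero.1 (hX _ e)).symm, fun e => by rw [e, sub_self, map_zero]⟩

theorem exists_eq_bdd_inverse {B : H →ₗ.[ℂ] H} (hB : B.IsAccretive) (hinv : B.HasBoundedInverse) :
    ∃ R : H →L[ℂ] H, Accretive R ∧ (∀ u, R u = 0 → u = 0) ∧ B = (bdd R).inverse := by
  obtain ⟨R, h1, h2⟩ := hinv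
  have hinj : ∀ u, R u = 0 → u = 0 := fun u hu => B.graph_fst_eq_zero_snd (h1 u) hu
  refine ⟨R, fun y => ?_, hinj, pmap_ext fun x y => ?_⟩
  · rcases eq_or_ne (R y) 0 with h | h
    · rw [h, inner_zero_right, Complex.zero_re]
    have hn : 0 < ‖R y‖ := norm_pos_iff.2 h
    obtain ⟨u, hu, hBu⟩ := B.mem_graph_iff.1 (h1 y)
    change (u : H) = R y at hu
    change B u = y at hBu
    -- The numerical range involves unit vectors only, so `u = R y` is normalized first; the value
    -- at `R y` is the conjugate of `⟪y, R y⟫`.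
    have h3 := hB _ ⟨((‖R y‖⁻¹ : ℝ) : ℂ) • u, by
      rw [Submodule.coe_smul, norm_smul, hu, Complex.norm_real, norm_inv, norm_norm,
        inv_mul_cancel₀ hn.ne'], rfl⟩
    rw [B.map_smul, Submodule.coe_smul, inner_smul_left, inner_smul_right, Complex.conj_ofReal,
      Complex.re_ofReal_mul, Complex.re_ofReal_mul, hu, hBu, ← inner_conj_symm,
      Complex.conj_re] at h3
    exact nonneg_of_mul_nonneg_right (nonneg_of_mul_nonneg_right h3 (inv_pos.2 hn)) (inv_pos.2 hn)
  · rw [mem_graph_bdd_inverse hinj]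
    constructor
    · intro h
      obtain ⟨u, hu, hBu⟩ := B.mem_graph_iff.1 h
      change (u : H) = x at hu
      change B u = y at hBu
      rw [← hu, ← hBu, h2]
    · rintro rfl
      exact h1 y

variable [CompleteSpace H]

/-- With `u = Q y` the numerical values of `Q⁻¹` are conjugates of values of the form of `Q`. The
range condition is checked at `λ = -1`, where it asks to solve `w + Q w = y`. -/
theorem isMSectorial_bdd_inverse {Q : H →L[ℂ] H} (hQ : Accretive Q) (hinj : ∀ u, Q u = 0 → u = 0)
    {α : ℝ} (h0 : 0 < α) (h1 : α < Real.pi / 2)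
    (hsec : ∀ u, |Real.cos α * (⟪u, Q u⟫_ℂ).im| ≤ Real.sin α * (⟪u, Q u⟫_ℂ).re) :
    (bdd Q).inverse.IsMSectorial α := by
  have hnum : ∀ z ∈ (bdd Q).inverse.numRange, ∃ y, z = (starRingEnd ℂ) ⟪y, Q y⟫_ℂ := by
    rintro z ⟨u, -, rfl⟩
    have hu := (mem_graph_bdd_inverse hinj).1 (LinearPMap.mem_graph _ u)
    refine ⟨(bdd Q).inverse u, ?_⟩
    rw [inner_conj_symm, ← hu]
  refine ⟨⟨fun z hz => ?_, ?_, -1, by norm_num, fun y => ?_⟩, fun z hz => ?_⟩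
  · obtain ⟨y, rfl⟩ := hnum z hz
    rw [Complex.conj_re]
    exact hQ y
  · rw [domain_bdd_inverse hinj]
    exact hQ.denseRange hinj
  · have hu := hQ.nonneg.isUnit 1 one_pos
    obtain ⟨w, hw⟩ : ∃ w, Q w + w = y := by
      refine ⟨Ring.inverse (Q + ((1 : ℝ) : ℂ) • 1) y, ?_⟩
      have := congr_arg (fun A : H →L[ℂ] H => A y) (Ring.mul_inverse_cancel _ hu)
      simpa only [mul_apply_eq_comp, add_apply, smul_apply, one_apply_eq_self, Complex.ofReal_one,
        one_smul] using this
    obtain ⟨x, hx, hx'⟩ :=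
      LinearPMap.mem_graph_iff _ |>.1 ((mem_graph_bdd_inverse (x := Q w) (y := w) hinj).2 rfl)
    refine ⟨x, ?_⟩
    rw [hx, hx', neg_one_smul, sub_neg_eq_add, add_comm]
    exact hw
  · obtain ⟨y, rfl⟩ := hnum z hz
    refine abs_arg_le_of_mul_abs_im_le h0 h1 ?_
    rw [Complex.conj_re, Complex.conj_im, mul_neg, abs_neg]
    exact hsec y

/-- The operators attached to the square root of `B`, in terms of bounded operators. -/
theorem exists_katoPair_of_isAccretive {B : H →ₗ.[ℂ] H} (hB : B.IsAccretive)
    (hinv : B.HasBoundedInverse) : ∃ X Z : H →L[ℂ] H, KatoPair X Z ∧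
      B.sqrtOp = (bdd (X * (1 + Z))).inverse ∧ B.adjoint.sqrtOp = (bdd (X * (1 - Z))).inverse ∧
      B.invSqrtOp.reOp = bdd X ∧ B.katoZ = bdd Z := by
  have hh0 : (0 : ℝ) < 1 / 2 := by norm_num
  have hh1 : (1 / 2 : ℝ) < 1 := by norm_num
  obtain ⟨R, hR, hRinj, rfl⟩ := exists_eq_bdd_inverse hB hinv
  have hS := hR.fpow hh0 hh1
  have hSinj := fpow_injective hh0 hh1 hR hRinj
  have hRinj' : ∀ u, star R u = 0 → u = 0 := fun u hu =>
    hRinj u (by simpa using hR.star.star_apply_eq_zero hu)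
  obtain ⟨X, Z, h, hX, hXZ, e1, e2⟩ := exists_katoPair hS
    (hR.fpow_half_mul_self.symm ▸ hR) hSinj
  have hinvS : (bdd R).inverse.invSqrtOp = bdd (fpow (1 / 2) R) := by
    rw [LinearPMap.invSqrtOp, sqrtOp_bdd_inverse hR hRinj,
      inverse_inverse (isInjective_bdd.2 hSinj)]
  have hre : (bdd R).inverse.invSqrtOp.reOp = bdd X := by
    rw [hinvS, LinearPMap.reOp, bdd_adjoint, bdd_add, bdd_smul, hX]
  refine ⟨X, Z, h, ?_, ?_, hre, ?_⟩
  · rw [← e1, sqrtOp_bdd_inverse hR hRinj]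
  · rw [← e2, star_fpow, bdd_inverse_adjoint hRinj hRinj', sqrtOp_bdd_inverse hR.star hRinj']
  · rw [LinearPMap.katoZ, hre, hinvS, LinearPMap.imOp, bdd_adjoint, bdd_sub, bdd_smul,
      bdd_inverse_pcomp (Y := Complex.I⁻¹ • Z) h.injective, bdd_smul,
      smul_inv_smul₀ Complex.I_ne_zero]
    rw [mul_smul_comm, hXZ, smul_smul]
    congr 1
    rw [one_div, one_div, mul_inv, mul_comm]

theorem katoZPow_eq (h0 : 0 < γ) (h1 : γ < 1) {B : H →ₗ.[ℂ] H} {Z : H →L[ℂ] H} (hZ : ‖Z‖ ≤ 1)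
    (h : B.katoZ = bdd Z) :
    (LinearPMap.idOp H + B.katoZ).fracPow γ + (LinearPMap.idOp H - B.katoZ).fracPow γ =
        bdd (fpow γ (1 + Z) + fpow γ (1 - Z)) ∧
      B.katoZPow γ = bdd (cpow γ Z) := by
  have hp : (LinearPMap.idOp H + B.katoZ).fracPow γ = bdd (fpow γ (1 + Z)) := by
    rw [h, idOp_eq_bdd, bdd_add, fracPow_bdd h0 h1 (accretive_one_add hZ)]
  have hm : (LinearPMap.idOp H - B.katoZ).fracPow γ = bdd (fpow γ (1 - Z)) := by
    rw [h, idOp_eq_bdd, bdd_sub, fracPow_bdd h0 h1 (accretive_one_sub hZ)]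
  rw [LinearPMap.katoZPow, hp, hm, bdd_add, bdd_sub,
    bdd_inverse_eq_of_isUnit (isUnit_fpow_add_fpow h0 h1 hZ), bdd_pcomp]
  exact ⟨rfl, rfl⟩

/-- A bounded accretive operator and its adjoint have the same kernel. -/
theorem one_sub_star_injective {W : H →L[ℂ] H} (hW : ‖W‖ ≤ 1) (h : ∀ u, (1 - W) u = 0 → u = 0)
    (u : H) (hu : (1 - star W) u = 0) : u = 0 := by
  refine h u ?_
  have := (accretive_one_sub ((norm_star W).trans_le hW)).star_apply_eq_zero hu
  rwa [star_sub, star_one, star_star] at this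

end

end FractionalPower

end

/-! ### The theorem, assembled from the bounded operators `X`, `Z` and `W = Z_γ`. -/

theorem mainTheorem5 {H : Type*} [NormedAddCommGroup H] [InnerProductSpace ℂ H] [CompleteSpace H]
    [TopologicalSpace.SeparableSpace H]
    (B : H →ₗ.[ℂ] H) (hB : B.IsMAccretive) (hunb : B.IsUnbounded) (hinv : B.HasBoundedInverse)
    (γ : ℝ) (hγ0 : 0 < γ) (hγ1 : γ < 1) :
    -- all inverses that enter the definitions exist, and `Z` is a contraction
    (B.sqrtOp.IsInjective ∧ B.invSqrtOp.reOp.IsInjective ∧ B.katoZ.IsContractionOp ∧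
      ((LinearPMap.idOp H + B.katoZ).fracPow γ +
        (LinearPMap.idOp H - B.katoZ).fracPow γ).IsInjective ∧
      (LinearPMap.idOp H + B.katoZPow γ).IsInjective ∧
      (LinearPMap.idOp H - (B.katoZPow γ).adjoint).IsInjective) ∧
    -- (1)
    ((B.katoZPow γ).MemClassC (Real.pi * γ / 2) ∧
      ∀ f ∈ B.katoL.domain, ∃ y : H,
        (f, y) ∈ (B.katoL ∘ₚ (B.katoZPow γ).adjoint).graph ∧
        (f, y) ∈ (-(B.katoZPow γ ∘ₚ B.katoL)).graph) ∧
    -- (2)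
    (B.katoL ∘ₚ ((LinearPMap.idOp H + B.katoZPow γ) ∘ₚ
          (LinearPMap.idOp H - (B.katoZPow γ).adjoint)).inverse ∘ₚ B.katoL = B.katoB γ ∧
      (B.katoB γ).IsMSectorial (Real.pi * γ / 2) ∧
      (B.katoB γ).sqrtOp = (LinearPMap.idOp H + B.katoZPow γ).inverse ∘ₚ B.katoL ∧
      (B.katoB γ).sqrtOp =
        B.katoL ∘ₚ (LinearPMap.idOp H - (B.katoZPow γ).adjoint).inverse) ∧
    -- (3)
    (B.sqrtOp.domain = B.adjoint.sqrtOp.domain ↔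
      (B.katoB γ).sqrtOp.domain = (B.katoB γ).adjoint.sqrtOp.domain) := by
  open FractionalPower in
  obtain ⟨X, Z, h, hsq, hsqa, hre, hZ⟩ := exists_katoPair_of_isAccretive hB.accretive hinv
  obtain ⟨hsum, hW⟩ := katoZPow_eq hγ0 hγ1 h.norm_le hZ
  have hL : B.katoL = (bdd X).inverse := by rw [LinearPMap.katoL, hre]
  have hk := h.cpow hγ0 hγ1
  have hrot := cpow_norm_rotate_le hγ0 hγ1 h.norm_le
  have hu1 := isUnit_one_add_cpow_iff hγ0 hγ1 h.norm_le
  have hu2 := isUnit_one_sub_cpow_iff hγ0 hγ1 h.norm_le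
  obtain ⟨W, hWdef⟩ : ∃ W, W = cpow γ Z := ⟨_, rfl⟩
  rw [← hWdef] at hW hk hrot hu1 hu2
  clear hWdef
  have hWa : (B.katoZPow γ).adjoint = bdd (star W) := by rw [hW, bdd_adjoint]
  have hstar := one_sub_star_injective hk.norm_le hk.injective_sub
  have hinvp : LinearPMap.idOp H + B.katoZPow γ = bdd (1 + W) := by
    rw [hW, idOp_eq_bdd, bdd_add]
  have hinvm : LinearPMap.idOp H - (B.katoZPow γ).adjoint = bdd (1 - star W) := by
    rw [hWa, idOp_eq_bdd, bdd_sub]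
  have hT : (1 - star W) * X = X * (1 + W) := hk.one_sub_star_mul
  have hTinj := hk.mul_injective
  have hTTinj : ∀ u, (X * (1 + W) * (X * (1 + W))) u = 0 → u = 0 := fun u hu =>
    hTinj u (hTinj _ hu)
  have hTTinj' : ∀ u, star (X * (1 + W) * (X * (1 + W))) u = 0 → u = 0 := fun u hu =>
    hk.star_mul_injective u (hk.star_mul_injective _ (by rwa [star_mul] at hu))
  -- Collecting the inverses gives the inverse of `(1 - W*) X · X (1 + W)`; moving `X` across the
  -- first factor turns this into the square of `X (1 + W)`.
  have hB' : B.katoB γ = (bdd (X * (1 + W) * (X * (1 + W)))).inverse := by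
    rw [LinearPMap.katoB, hinvp, hinvm, hL, bdd_inverse_pcomp_inverse h.injective h.injective,
      bdd_inverse_pcomp_inverse (fun u hu => h.injective u (h.injective _ hu)) hstar,
      bdd_inverse_pcomp_inverse hk.injective_add fun u hu =>
        h.injective u (h.injective _ (hstar _ hu)), ← mul_assoc (1 - star W), hT]
    simp only [mul_assoc]
  have hsqB : (B.katoB γ).sqrtOp = (bdd (X * (1 + W))).inverse := by
    rw [hB', sqrtOp_bdd_inverse hk.accretive_sq hTTinj, hk.fpow_half_sq]
  have hsqBa : (B.katoB γ).adjoint.sqrtOp = (bdd (X * (1 - W))).inverse := by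
    rw [hB', bdd_inverse_adjoint hTTinj hTTinj', sqrtOp_bdd_inverse hk.accretive_sq.star hTTinj',
      ← star_fpow, hk.fpow_half_sq, hk.star_mul_one_add]
  have hdom : ∀ {Y : H →L[ℂ] H}, KatoPair X Y → ((bdd (X * (1 + Y))).inverse.domain =
      (bdd (X * (1 - Y))).inverse.domain ↔ IsUnit (1 + Y) ∧ IsUnit (1 - Y)) := fun {Y} hY => by
    rw [← hY.range_eq_iff, ← domain_bdd_inverse hY.mul_injective, ← domain_bdd_inverse
      (W := X * (1 - Y)) fun u hu => hY.injective_sub u (hY.injective _ hu), SetLike.coe_set_eq]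
  have hcos := Real.pi_pos
  refine ⟨⟨?_, ?_, ?_, ?_, ?_, ?_⟩, ⟨⟨W, hW, hrot⟩, fun f hf => ?_⟩, ⟨?_, ?_, ?_, ?_⟩, ?_⟩
  · rw [hsq]
    exact isInjective_inverse (isInjective_bdd.2 h.mul_injective)
  · rw [hre]
    exact isInjective_bdd.2 h.injective
  · rw [hZ]
    refine ⟨rfl, fun x => ?_⟩
    have := Z.le_of_opNorm_le h.norm_le x
    rwa [one_mul] at this
  · rw [hsum, isInjective_bdd]
    intro u hu
    have hN := isUnit_fpow_add_fpow hγ0 hγ1 h.norm_le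
    rw [← one_apply_eq_self (F := H →L[ℂ] H) u, ← Ring.inverse_mul_cancel _ hN, mul_apply_eq_comp,
      hu, map_zero]
  · rw [hinvp]
    exact isInjective_bdd.2 hk.injective_add
  · rw [hinvm]
    exact isInjective_bdd.2 hstar
  · rw [hL] at hf ⊢
    rw [hWa, hW]
    obtain ⟨g, hg⟩ := LinearPMap.mem_domain_iff.1 hf
    obtain rfl := (mem_graph_bdd_inverse h.injective).1 hg
    refine ⟨-W g, (LinearPMap.mem_graph_pcomp _ _ _ _).2 ⟨_, mem_graph_bdd.2 rfl,
      (mem_graph_bdd_inverse h.injective).2 ?_⟩, mem_graph_neg.2 ⟨_,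
        (LinearPMap.mem_graph_pcomp _ _ _ _).2 ⟨g, hg, mem_graph_bdd.2 rfl⟩, rfl⟩⟩
    rw [← mul_apply_eq_comp, hk.star_mul_eq, neg_apply, mul_apply_eq_comp, map_neg]
  · rw [hB', hinvp, hinvm, hL, bdd_pcomp,
      bdd_inverse_pcomp_inverse (fun u hu => hstar u (hk.injective_add _ hu)) h.injective,
      bdd_inverse_pcomp_inverse h.injective fun u hu =>
        hstar u (hk.injective_add _ (h.injective _ hu)), ← mul_assoc X, mul_assoc, hT]
  · rw [hB']
    refine isMSectorial_bdd_inverse hk.accretive_sq hTTinj (by positivity) (by nlinarith) ?_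
    exact hk.sector_sq (Real.sin_sq_add_cos_sq _) (cos_pos_sin_pos hγ0 hγ1).2 hrot.1 hrot.2
  · rw [hsqB, hinvp, hL, bdd_inverse_pcomp_inverse hk.injective_add h.injective]
  · rw [hsqB, hinvm, hL, bdd_inverse_pcomp_inverse h.injective hstar, hT]
  -- Both equalities of domains become the invertibility of a pair `1 ± Y`, for `Y = Z` and `Y = W`,
  -- and these conditions are equivalent factor by factor.
  · rw [hsq, hsqa, hsqB, hsqBa, hdom h, hdom hk, hu1, hu2]
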